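/- Let $\theta_1,\theta_2\in\mathbb R$ be no integer multiples of $\pi/2$, and put $c_i=\cos\theta_i$, $s_i=\sin\theta_i$ and $U_i=\begin{bmatrix}c_i&s_i\\ s_i&-c_i\end{bmatrix}$ on $\mathbb C^2=\mathrm{span}\{|0\rangle,|1\rangle\}$ $(i=1,2)$. On $\ell^2(\mathbb Z)\otimes\mathbb C^2\otimes\mathbb C^2$, with $|j_1j_2\rangle=|j_1\rangle\otimes|j_2\rangle$, let $$X=\sum_{x}|x\rangle\langle x|\otimes(U_2\otimes U_1),\qquad Y=\sum_{x}|x\rangle\langle x|\otimes(U_1\otimes U_2),$$ $$S=\sum_{x}\Bigl(|x-1\rangle\langle x|\otimes|00\rangle\langle00|+|x\rangle\langle x|\otimes|01\rangle\langle01|+|x\rangle\langle x|\otimes|10\rangle\langle10|+|x+1\rangle\langle x|\otimes|11\rangle\langle11|\Bigr).$$ Let $q_0,q_1,q_2,q_3\in\mathbb C$ with $|q_0|^2+|q_1|^2+|q_2|^2+|q_3|^2=1$, let $$|\Psi_t\rangle=(SYSX)^t\,|0\rangle\otimes\bigl(q_0|00\rangle+q_1|01\rangle+q_2|10\rangle+q_3|11\rangle\bigr)\qquad(t=0,1,2,\ldots),$$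 and let $\mathbb P(X_t=x)=\langle\Psi_t|\bigl(|x\rangle\langle x|\otimes I\bigr)|\Psi_t\rangle$ be the probability of finding the walker at $x\in\mathbb Z$ at time $t$. Then for every $x\in\mathbb Z$ the limit of $\mathbb P(X_t=x)$ as $t\to\infty$ exists and $$\lim_{t\to\infty}\mathbb P(X_t=x)=|\xi_1(x;q_0,q_1,q_2,q_3)|^2+|\xi_1(-x;q_3,-q_2,-q_1,q_0)|^2+|\xi_2(x;q_0,q_1,q_2,q_3)|^2+|\xi_2(-x;-q_3,q_2,q_1,-q_0)|^2.$$ Here $$\xi_1(x;q_0,q_1,q_2,q_3)=\eta_1(x)q_0-\eta_3(x)q_1-\eta_3(-x-1)q_2-\eta_1(x+1)q_3,$$ $$\xi_2(x;q_0,q_1,q_2,q_3)=-\eta_3(-x)q_0+(\delta_{0x}-\eta_1(x))q_1+\eta_2(-x)q_2+\eta_3(-x-1)q_3,$$ where $\delta_{0x}=1$ if $x=0$ and $0$ otherwise. With $$\nu_1=\frac{(1+s_1)(1-s_2)}{c_1c_2},\qquad \nu_2=-\frac{(1+s_1)(1+s_2)}{c_1c_2}$$ and $I(P)=1$ if $P$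 is true, $I(P)=0$ otherwise, the coefficients are $$\eta_1(x)=-\tfrac14\Bigl[(s_1-s_2)\bigl\{\nu_1^{|x|}I(s_1<s_2)-\nu_1^{-|x|}I(s_1>s_2)\bigr\}+(s_1+s_2)\bigl\{\nu_2^{|x|}I(s_1<-s_2)-\nu_2^{-|x|}I(s_1>-s_2)\bigr\}\Bigr];$$ for $x\ge0$, $$\eta_2(x)=\tfrac14\Bigl[(s_1-s_2)\bigl\{\nu_2\nu_1^{x}I(s_1<s_2)-\nu_2^{-1}\nu_1^{-x}I(s_1>s_2)\bigr\}+(s_1+s_2)\bigl\{\nu_1\nu_2^{x}I(s_1<-s_2)-\nu_1^{-1}\nu_2^{-x}I(s_1>-s_2)\bigr\}\Bigr],$$ $$\eta_3(x)=\tfrac{c_1}4\Bigl[(s_1-s_2)\bigl\{\tfrac{1}{1-s_1}\nu_1^{x}I(s_1<s_2)+\tfrac1{1+s_1}\nu_1^{-x}I(s_1>s_2)\bigr\}+(s_1+s_2)\bigl\{\tfrac1{1-s_1}\nu_2^{x}I(s_1<-s_2)+\tfrac1{1+s_1}\nu_2^{-x}I(s_1>-s_2)\bigr\}\Bigr];$$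 and for $x\le-1$, $$\eta_2(x)=\tfrac14\Bigl[(s_1-s_2)\bigl\{\nu_2^{-1}\nu_1^{-x}I(s_1<s_2)-\nu_2\nu_1^{x}I(s_1>s_2)\bigr\}+(s_1+s_2)\bigl\{\nu_1^{-1}\nu_2^{-x}I(s_1<-s_2)-\nu_1\nu_2^{x}I(s_1>-s_2)\bigr\}\Bigr],$$ $$\eta_3(x)=-\tfrac{c_1}4\Bigl[(s_1-s_2)\bigl\{\tfrac1{1+s_1}\nu_1^{-x}I(s_1<s_2)+\tfrac1{1-s_1}\nu_1^{x}I(s_1>s_2)\bigr\}+(s_1+s_2)\bigl\{\tfrac1{1+s_1}\nu_2^{-x}I(s_1<-s_2)+\tfrac1{1-s_1}\nu_2^{x}I(s_1>-s_2)\bigr\}\Bigr].$$ -/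

import Mathlib

open Filter Topology
open scoped Kronecker

namespace FourStateWalk

noncomputable section

/-- Coin basis labels `(j₁, j₂)`, standing for `|j₁ j₂⟩ = |j₁⟩ ⊗ |j₂⟩`. -/
abbrev Coin := Fin 2 × Fin 2

/-- Amplitude fields on the line: `Ψ x j` is the coefficient of `|x⟩ ⊗ |j⟩`. All operators of the
walk are local, so they act on arbitrary amplitude fields (in particular on `ℓ²(ℤ) ⊗ ℂ⁴`). -/
abbrev State := ℤ → Coin → ℂ

/-- The one-qubit coin `c|0⟩⟨0| + s|0⟩⟨1| + s|1⟩⟨0| - c|1⟩⟨1|` with `c = cos θ`, `s = sin θ`. -/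
def U (θ : ℝ) : Matrix (Fin 2) (Fin 2) ℂ :=
  !![(Real.cos θ : ℂ), (Real.sin θ : ℂ); (Real.sin θ : ℂ), -(Real.cos θ : ℂ)]

/-- The operator `∑ₓ |x⟩⟨x| ⊗ M`: apply the coin matrix `M` at every site. -/
def coinFlip (M : Matrix Coin Coin ℂ) : Module.End ℂ State where
  toFun Ψ := fun x => M.mulVec (Ψ x)
  map_add' Ψ Φ := by
    funext x
    exact Matrix.mulVec_add M (Ψ x) (Φ x)
  map_smul' a Ψ := by
    funext x
    exact Matrix.mulVec_smul M a (Ψ x)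

/-- The coin flip `X = ∑ₓ |x⟩⟨x| ⊗ (U₂ ⊗ U₁)`. -/
def opX (θ₁ θ₂ : ℝ) : Module.End ℂ State := coinFlip (U θ₂ ⊗ₖ U θ₁)

/-- The coin flip `Y = ∑ₓ |x⟩⟨x| ⊗ (U₁ ⊗ U₂)`. -/
def opY (θ₁ θ₂ : ℝ) : Module.End ℂ State := coinFlip (U θ₁ ⊗ₖ U θ₂)

/-- Displacement of the walker: `-1` for `|00⟩`, `0` for `|01⟩` and `|10⟩`, `+1` for `|11⟩`. -/
def disp (j : Coin) : ℤ := !![(-1 : ℤ), 0; 0, 1] j.1 j.2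

/-- The position shift `S = ∑ₓ ∑ⱼ |x + disp j⟩⟨x| ⊗ |j⟩⟨j|`. -/
def opS : Module.End ℂ State where
  toFun Ψ := fun x j => Ψ (x - disp j) j
  map_add' _ _ := rfl
  map_smul' _ _ := rfl

/-- The localized initial state `|0⟩ ⊗ (q₀|00⟩ + q₁|01⟩ + q₂|10⟩ + q₃|11⟩)`. -/
def initial (q₀ q₁ q₂ q₃ : ℂ) : State :=
  fun x j => if x = 0 then !![q₀, q₁; q₂, q₃] j.1 j.2 else 0

/-- The state `Ψ_t = (S Y S X)^t Ψ_0`. -/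
def state (θ₁ θ₂ : ℝ) (q₀ q₁ q₂ q₃ : ℂ) (t : ℕ) : State :=
  ((opS * opY θ₁ θ₂ * opS * opX θ₁ θ₂) ^ t) (initial q₀ q₁ q₂ q₃)

/-- The probability `ℙ(X_t = x) = ⟨Ψ_t| (|x⟩⟨x| ⊗ ∑ⱼ |j⟩⟨j|) |Ψ_t⟩`. -/
def prob (θ₁ θ₂ : ℝ) (q₀ q₁ q₂ q₃ : ℂ) (t : ℕ) (x : ℤ) : ℝ :=
  ∑ j : Coin, ‖state θ₁ θ₂ q₀ q₁ q₂ q₃ t x j‖ ^ 2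

/-- The indicator `I(P)`. -/
def ind (P : Prop) [Decidable P] : ℝ := if P then 1 else 0

/-- `ν₁ = (1 + s₁)(1 - s₂) / (c₁ c₂)`. -/
def ν₁ (θ₁ θ₂ : ℝ) : ℝ :=
  (1 + Real.sin θ₁) * (1 - Real.sin θ₂) / (Real.cos θ₁ * Real.cos θ₂)

/-- `ν₂ = -(1 + s₁)(1 + s₂) / (c₁ c₂)`. -/
def ν₂ (θ₁ θ₂ : ℝ) : ℝ :=
  -((1 + Real.sin θ₁) * (1 + Real.sin θ₂) / (Real.cos θ₁ * Real.cos θ₂))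

def η₁ (θ₁ θ₂ : ℝ) (x : ℤ) : ℝ :=
  let s₁ := Real.sin θ₁
  let s₂ := Real.sin θ₂
  let n₁ := ν₁ θ₁ θ₂
  let n₂ := ν₂ θ₁ θ₂
  (-(1 / 4)) *
    ((s₁ - s₂) * (n₁ ^ |x| * ind (s₁ < s₂) - n₁ ^ (-|x|) * ind (s₁ > s₂))
      + (s₁ + s₂) * (n₂ ^ |x| * ind (s₁ < -s₂) - n₂ ^ (-|x|) * ind (s₁ > -s₂)))

def η₂ (θ₁ θ₂ : ℝ) (x : ℤ) : ℝ :=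
  let s₁ := Real.sin θ₁
  let s₂ := Real.sin θ₂
  let n₁ := ν₁ θ₁ θ₂
  let n₂ := ν₂ θ₁ θ₂
  if 0 ≤ x then
    (1 / 4) *
      ((s₁ - s₂) * (n₂ * n₁ ^ x * ind (s₁ < s₂) - n₂⁻¹ * n₁ ^ (-x) * ind (s₁ > s₂))
        + (s₁ + s₂) * (n₁ * n₂ ^ x * ind (s₁ < -s₂) - n₁⁻¹ * n₂ ^ (-x) * ind (s₁ > -s₂)))
  else
    (1 / 4) *
      ((s₁ - s₂) * (n₂⁻¹ * n₁ ^ (-x) * ind (s₁ < s₂) - n₂ * n₁ ^ x * ind (s₁ > s₂))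
        + (s₁ + s₂) * (n₁⁻¹ * n₂ ^ (-x) * ind (s₁ < -s₂) - n₁ * n₂ ^ x * ind (s₁ > -s₂)))

def η₃ (θ₁ θ₂ : ℝ) (x : ℤ) : ℝ :=
  let c₁ := Real.cos θ₁
  let s₁ := Real.sin θ₁
  let s₂ := Real.sin θ₂
  let n₁ := ν₁ θ₁ θ₂
  let n₂ := ν₂ θ₁ θ₂
  if 0 ≤ x then
    (c₁ / 4) *
      ((s₁ - s₂) * (1 / (1 - s₁) * n₁ ^ x * ind (s₁ < s₂)
          + 1 / (1 + s₁) * n₁ ^ (-x) * ind (s₁ > s₂))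
        + (s₁ + s₂) * (1 / (1 - s₁) * n₂ ^ x * ind (s₁ < -s₂)
          + 1 / (1 + s₁) * n₂ ^ (-x) * ind (s₁ > -s₂)))
  else
    (-(c₁ / 4)) *
      ((s₁ - s₂) * (1 / (1 + s₁) * n₁ ^ (-x) * ind (s₁ < s₂)
          + 1 / (1 - s₁) * n₁ ^ x * ind (s₁ > s₂))
        + (s₁ + s₂) * (1 / (1 + s₁) * n₂ ^ (-x) * ind (s₁ < -s₂)
          + 1 / (1 - s₁) * n₂ ^ x * ind (s₁ > -s₂)))

def ξ₁ (θ₁ θ₂ : ℝ) (x : ℤ) (q₀ q₁ q₂ q₃ : ℂ) : ℂ :=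
  (η₁ θ₁ θ₂ x : ℂ) * q₀ - (η₃ θ₁ θ₂ x : ℂ) * q₁
    - (η₃ θ₁ θ₂ (-x - 1) : ℂ) * q₂ - (η₁ θ₁ θ₂ (x + 1) : ℂ) * q₃

def ξ₂ (θ₁ θ₂ : ℝ) (x : ℤ) (q₀ q₁ q₂ q₃ : ℂ) : ℂ :=
  -(η₃ θ₁ θ₂ (-x) : ℂ) * q₀ + ((ind (x = 0) - η₁ θ₁ θ₂ x : ℝ) : ℂ) * q₁
    + (η₂ θ₁ θ₂ (-x) : ℂ) * q₂ + (η₃ θ₁ θ₂ (-x - 1) : ℂ) * q₃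

end

end FourStateWalk

/-!
The walk is translation invariant, so it is diagonalised by `Ψ x j = (2π)⁻¹ ∫ e^{ikx} f(k, j) dk`.
At momentum `k` one step `S Y S X` is the tensor product `A ⊗ B` of two matrices in `SU(2)`,
`A = factor θ₁ θ₂ k` and `B = factor θ₂ θ₁ k` (`step_amplitude`), because the shift
`diag(e^{ik}, 1, 1, e^{-ik})` is itself a tensor square. Both factors have half-trace
`cos ω(k) = c₁ c₂ cos k + s₁ s₂`, so that `A = cos ω + sin ω J` and `B = cos ω + sin ω J'` with
`J² = J'² = -1`, and `(A ⊗ B)^t` has the eigenvalues `1, 1, e^{2itω}, e^{-2itω}`: it is the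
projection `(1 + J ⊗ J') / 2` onto the flat band plus two parts that rotate with the phases `± 2tω`
(`stepMatrix_pow_apply`). Since `ω` is monotone on `(-π, 0)` and on `(0, π)`, the Riemann-Lebesgue
lemma makes the rotating parts vanish at every fixed site (`tendsto_amplitude_exp`). Hence `Ψ_t x`
converges to the Fourier coefficients of the flat-band projection of the initial state, and the
probability to the sum of the squared moduli of the four components.

It remains to compute these coefficients. The entries of `J ⊗ J'` are trigonometric polynomials
divided by `sin² ω = (1 - cos ω)(1 + cos ω)`. Their partial fractions (`amplitude_flatBand`) involve
`(s₁ - s₂) / (1 - cos ω)` and `(s₁ + s₂) / (1 + cos ω)`, which are multiples of Poisson kernels with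
ratios `ν₁^{±1}` and `ν₂^{±1}`, the sign being chosen such that the ratio has modulus less than `1`
(`amplitude_polePart`). So all coefficients are combinations of the two decaying modes and of their
translates by one site, and this is what `η₁`, `η₂`, `η₃` are (`η₁_eq`, `η₂_eq`, `η₃_eq`).
When `s₁ = ± s₂` one of the poles reaches the unit circle. Its fraction then vanishes identically
away from the pole, and so does its mode, so this case needs no separate treatment.
-/

namespace FourStateWalk

noncomputable section

open MeasureTheory

/-! ### The Riemann-Lebesgue lemma with a monotone phase -/

open FourierTransform in
/-- The Riemann-Lebesgue lemma for an injective phase without critical points: `φ` is taken as the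
integration variable. No integrability of `g` is needed, since the Bochner integrals on both sides
of the substitution are `0` by convention without it. -/
theorem tendsto_setIntegral_exp_phase {s : Set ℝ} (hs : MeasurableSet s) {φ φ' : ℝ → ℝ}
    (hφ : ∀ k ∈ s, HasDerivWithinAt φ (φ' k) s k) (h0 : ∀ k ∈ s, φ' k ≠ 0) (hinj : Set.InjOn φ s)
    (g : ℝ → ℂ) :
    Tendsto (fun t : ℝ => ∫ k in s, Complex.exp (t * φ k * Complex.I) * g k)
      (cocompact ℝ) (𝓝 0) := by
  set ψ := Function.invFunOn φ s
  have hψ : ∀ k ∈ s, ψ (φ k) = k := fun k hk => hinj.leftInvOn_invFunOn hk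
  have hm : MeasurableSet (φ '' s) :=
    hs.image_of_continuousOn_injOn (fun k hk => (hφ k hk).continuousWithinAt) hinj
  have key := Real.tendsto_integral_exp_smul_cocompact
    ((φ '' s).indicator fun y => ((|φ' (ψ y)| : ℝ) : ℂ)⁻¹ * g (ψ y))
  have hscale : Tendsto (fun t : ℝ => (-(2 * Real.pi)⁻¹) * t) (cocompact ℝ) (cocompact ℝ) :=
    (Homeomorph.mulLeft₀ _ (by simp [Real.pi_ne_zero])).isClosedEmbedding.tendsto_cocompact
  refine (key.comp hscale).congr fun t => ?_
  have : ∀ y, (𝐞 (-(y * ((-(2 * Real.pi)⁻¹) * t)))) •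
      ((φ '' s).indicator (fun y => ((|φ' (ψ y)| : ℝ) : ℂ)⁻¹ * g (ψ y)) y)
      = (φ '' s).indicator (fun y => Complex.exp (t * y * Complex.I) *
        (((|φ' (ψ y)| : ℝ) : ℂ)⁻¹ * g (ψ y))) y := by
    intro y
    by_cases hy : y ∈ φ '' s
    · simp only [Set.indicator_of_mem hy, Circle.smul_def, Real.fourierChar_apply, smul_eq_mul]
      congr 2
      have := Real.pi_ne_zero
      push_cast
      field_simp
    · simp [Set.indicator_of_notMem hy]
  simp only [Function.comp, this]
  rw [integral_indicator hm, integral_image_eq_integral_abs_deriv_smul hs hφ hinj]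
  refine setIntegral_congr_fun hs fun k hk => ?_
  have := abs_ne_zero.2 (h0 k hk)
  simp only [hψ k hk, Complex.real_smul]
  have h : ((|φ' k| : ℝ) : ℂ) ≠ 0 := by exact_mod_cast this
  field_simp

/-! ### Fourier coefficients of momentum profiles -/

/-- The point `e^{ik}` of the unit circle. -/
def zeta (k : ℝ) : ℂ := Complex.exp (k * Complex.I)

theorem zeta_ne_zero (k : ℝ) : zeta k ≠ 0 := Complex.exp_ne_zero _

theorem norm_zeta (k : ℝ) : ‖zeta k‖ = 1 := Complex.norm_exp_ofReal_mul_I k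

theorem zeta_zpow (k : ℝ) (n : ℤ) : zeta k ^ n = Complex.exp (n * Complex.I * k) := by
  rw [zeta, ← Complex.exp_int_mul]
  ring_nf

theorem zeta_eq (k : ℝ) : zeta k = Real.cos k + Real.sin k * Complex.I := by
  rw [zeta, Complex.exp_mul_I, Complex.ofReal_cos, Complex.ofReal_sin]

theorem zeta_inv_eq (k : ℝ) : (zeta k)⁻¹ = Real.cos k - Real.sin k * Complex.I := by
  rw [zeta, ← Complex.exp_neg, ← neg_mul, Complex.exp_mul_I, Complex.cos_neg, Complex.sin_neg,
    Complex.ofReal_cos, Complex.ofReal_sin]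
  ring

theorem continuous_zeta_zpow (n : ℤ) : Continuous fun k => zeta k ^ n := by
  simp only [zeta_zpow]
  fun_prop

/-- The amplitude `(2π)⁻¹ ∫_{-π}^{π} e^{ikx} f(k) dk` at the site `x` of the wave with momentum
profile `f`. -/
def amplitude (f : ℝ → ℂ) (x : ℤ) : ℂ :=
  (2 * Real.pi : ℂ)⁻¹ * ∫ k in (-Real.pi)..Real.pi, zeta k ^ x * f k

/-- Integrability of a momentum profile over one period. -/
abbrev PeriodIntegrable (f : ℝ → ℂ) : Prop :=
  IntervalIntegrable f volume (-Real.pi) Real.pi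

theorem PeriodIntegrable.zeta_mul {f : ℝ → ℂ} (hf : PeriodIntegrable f) (n : ℤ) :
    PeriodIntegrable fun k => zeta k ^ n * f k :=
  hf.continuousOn_mul (continuous_zeta_zpow n).continuousOn

theorem amplitude_add {f g : ℝ → ℂ} (hf : PeriodIntegrable f) (hg : PeriodIntegrable g) (x : ℤ) :
    amplitude (fun k => f k + g k) x = amplitude f x + amplitude g x := by
  simp only [amplitude, mul_add]
  rw [intervalIntegral.integral_add (hf.zeta_mul x) (hg.zeta_mul x), mul_add]

theorem amplitude_const_mul (a : ℂ) (f : ℝ → ℂ) (x : ℤ) :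
    amplitude (fun k => a * f k) x = a * amplitude f x := by
  simp only [amplitude, mul_left_comm _ a, intervalIntegral.integral_const_mul]

theorem amplitude_sum {ι : Type*} (s : Finset ι) {f : ι → ℝ → ℂ}
    (hf : ∀ i ∈ s, PeriodIntegrable (f i)) (x : ℤ) :
    amplitude (fun k => ∑ i ∈ s, f i k) x = ∑ i ∈ s, amplitude (f i) x := by
  simp only [amplitude, Finset.mul_sum]
  rw [intervalIntegral.integral_finsetSum fun i hi => (hf i hi).zeta_mul x, Finset.mul_sum]

theorem amplitude_zeta_mul (n : ℤ) (f : ℝ → ℂ) (x : ℤ) :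
    amplitude (fun k => zeta k ^ n * f k) x = amplitude f (x + n) := by
  simp only [amplitude, zpow_add₀ (zeta_ne_zero _), mul_assoc]

theorem amplitude_congr {f g : ℝ → ℂ}
    (h : ∀ k ∈ Set.Ioo (-Real.pi) Real.pi, k ≠ 0 → f k = g k) (x : ℤ) :
    amplitude f x = amplitude g x := by
  have hp := Real.pi_pos
  rw [amplitude, amplitude, intervalIntegral.integral_congr_ae]
  filter_upwards [Measure.ae_ne volume (0 : ℝ), Measure.ae_ne volume Real.pi] with k h0 h1 hk
  rw [Set.uIoc_of_le (by linarith)] at hk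
  rw [h k ⟨hk.1, lt_of_le_of_ne hk.2 h1⟩ h0]

theorem amplitude_one (x : ℤ) : amplitude (fun _ => 1) x = if x = 0 then 1 else 0 := by
  have hp : (Real.pi : ℂ) ≠ 0 := by exact_mod_cast Real.pi_ne_zero
  simp only [amplitude, mul_one, zeta_zpow]
  split_ifs with h
  · subst h
    simp
    field_simp
    norm_num
  · have hx : (x : ℂ) ≠ 0 := by exact_mod_cast h
    rw [integral_exp_mul_complex (mul_ne_zero hx Complex.I_ne_zero)]
    have : Complex.exp (x * Complex.I * (Real.pi : ℝ))
        = Complex.exp (x * Complex.I * ((-Real.pi : ℝ) : ℂ)) := by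
      rw [Complex.exp_eq_exp_iff_exists_int]
      exact ⟨x, by push_cast; ring⟩
    rw [this, sub_self, zero_div, mul_zero]

/-- The Poisson kernel as a two-sided geometric series. -/
theorem hasSum_poisson {ρ : ℝ} (hρ : |ρ| < 1) {z : ℂ} (hz : ‖z‖ = 1) :
    HasSum (fun n : ℤ => (ρ : ℂ) ^ n.natAbs * z ^ n)
      ((1 - ρ ^ 2) / (1 - ρ * (z + z⁻¹) + ρ ^ 2)) := by
  have hz0 : z ≠ 0 := norm_ne_zero_iff.1 (by simp [hz])
  have h1 : ‖(ρ : ℂ) * z‖ < 1 := by simpa [hz] using hρ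
  have h2 : ‖(ρ : ℂ) * z⁻¹‖ < 1 := by simpa [hz] using hρ
  have ne : ∀ w : ℂ, ‖w‖ < 1 → 1 - w ≠ 0 := fun w hw h => by
    rw [sub_eq_zero] at h
    simp [← h] at hw
  have H := HasSum.of_nat_of_neg (f := fun n : ℤ => (ρ : ℂ) ^ n.natAbs * z ^ n)
    (g := (1 - ρ * z)⁻¹) (g' := (1 - ρ * z⁻¹)⁻¹)
    (by simpa [mul_pow] using hasSum_geometric_of_norm_lt_one h1)
    (by simpa [mul_pow] using hasSum_geometric_of_norm_lt_one h2)
  suffices h : (1 - ρ ^ 2) / (1 - ρ * (z + z⁻¹) + ρ ^ 2) = (1 - ρ * z)⁻¹ + (1 - ρ * z⁻¹)⁻¹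
      - (ρ : ℂ) ^ Int.natAbs 0 * z ^ (0 : ℤ) by
    rw [h]
    exact H
  have e1 := ne _ h1
  have e2 := ne _ h2
  have hfac : 1 - ρ * (z + z⁻¹) + ρ ^ 2 = (1 - ρ * z) * (1 - ρ * z⁻¹) := by
    field_simp
    ring
  rw [hfac]
  simp only [Int.natAbs_zero, pow_zero, zpow_zero, mul_one]
  rw [div_eq_iff (mul_ne_zero e1 e2)]
  generalize hw : z⁻¹ = w at *
  have hzw : z * w = 1 := by rw [← hw, mul_inv_cancel₀ hz0]
  have i1 := inv_mul_cancel₀ e1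
  have i2 := inv_mul_cancel₀ e2
  linear_combination (-(1 - ρ * w)) * i1 - (1 - ρ * z) * i2 + ρ ^ 2 * hzw

theorem amplitude_poisson {ρ : ℝ} (hρ : |ρ| < 1) (x : ℤ) :
    amplitude (fun k => (1 - ρ ^ 2) / (1 - ρ * (zeta k + (zeta k)⁻¹) + ρ ^ 2)) x
      = ρ ^ x.natAbs := by
  have hsum : Summable fun n : ℤ => |ρ| ^ n.natAbs := by
    have := summable_geometric_of_lt_one (abs_nonneg ρ) hρ
    exact Summable.of_nat_of_neg (by simpa using this) (by simpa using this)
  have H := intervalIntegral.hasSum_integral_of_dominated_convergence (μ := volume)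
    (a := -Real.pi) (b := Real.pi)
    (F := fun (n : ℤ) k => zeta k ^ x * ((ρ : ℂ) ^ n.natAbs * zeta k ^ n))
    (fun (n : ℤ) _ => |ρ| ^ n.natAbs)
    (fun n => ((continuous_zeta_zpow x).mul
      (continuous_const.mul (continuous_zeta_zpow n))).aestronglyMeasurable)
    (fun n => .of_forall fun k _ => by simp [norm_zeta])
    (.of_forall fun k _ => hsum) (by simp)
    (.of_forall fun k _ => (hasSum_poisson hρ (norm_zeta k)).mul_left (zeta k ^ x))
  have H2 := H.mul_left (2 * Real.pi : ℂ)⁻¹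
  change HasSum (fun n : ℤ => amplitude (fun k => (ρ : ℂ) ^ n.natAbs * zeta k ^ n) x) _ at H2
  refine H2.unique ?_
  have : ∀ n : ℤ, amplitude (fun k => (ρ : ℂ) ^ n.natAbs * zeta k ^ n) x
      = if n = -x then (ρ : ℂ) ^ x.natAbs else 0 := by
    intro n
    have h := amplitude_zeta_mul n (fun _ => 1) x
    simp only [mul_one] at h
    rw [amplitude_const_mul, h, amplitude_one]
    by_cases hn : n = -x
    · subst hn
      simp
    · rw [if_neg (by omega), if_neg hn, mul_zero]
  simp only [this]
  exact hasSum_ite_eq (-x) _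

/-! ### The two poles and their geometrically decaying modes -/

/-- The decaying solution attached to a pole: with `d = s₁ ∓ s₂` and `r = ν₁, ν₂`, this is the
bounded one among `-r ^ |x|` and `r ^ (-|x|)`, and `0` when the pole disappears (`d = 0`). -/
def decayMode (r d : ℝ) (x : ℤ) : ℝ :=
  if d < 0 then -r ^ |x| else if 0 < d then r ^ (-|x|) else 0

/-- The ratio `(1 + s₁)(1 - s₂) / (c₁ c₂)`. -/
def ratio (c₁ s₁ c₂ s₂ : ℝ) : ℝ := (1 + s₁) * (1 - s₂) / (c₁ * c₂)

/-- The summand with denominator `1 - s₁ s₂ - c₁ c₂ cos k` in the partial fraction expansion of the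
flat-band projection; replacing `(c₂, s₂)` by `(-c₂, -s₂)` gives the other one. -/
def polePart (c₁ s₁ c₂ s₂ k : ℝ) : ℂ :=
  ((s₁ - s₂ : ℝ) : ℂ) /
    (1 - ((s₁ * s₂ : ℝ) : ℂ) - ((c₁ * c₂ : ℝ) : ℂ) * (zeta k + (zeta k)⁻¹) / 2)

section
variable {c₁ s₁ c₂ s₂ : ℝ} (h₁ : c₁ ^ 2 + s₁ ^ 2 = 1) (h₂ : c₂ ^ 2 + s₂ ^ 2 = 1)
  (n₁ : c₁ ≠ 0) (n₂ : c₂ ≠ 0)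

theorem one_add_pos {c s : ℝ} (h : c ^ 2 + s ^ 2 = 1) (n : c ≠ 0) : 0 < 1 + s := by
  have := pow_pos (abs_pos.2 n) 2
  rw [sq_abs] at this
  nlinarith

theorem one_sub_pos {c s : ℝ} (h : c ^ 2 + s ^ 2 = 1) (n : c ≠ 0) : 0 < 1 - s := by
  simpa [sub_eq_add_neg] using one_add_pos (c := c) (s := -s) (by simpa using h) n

include h₁ h₂ n₁ n₂ in
theorem ratio_ne_zero : ratio c₁ s₁ c₂ s₂ ≠ 0 := by
  have := (one_add_pos h₁ n₁).ne'
  have := (one_sub_pos h₂ n₂).ne'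
  unfold ratio
  positivity

include h₁ h₂ n₁ n₂ in
theorem ratio_inv : (ratio c₁ s₁ c₂ s₂)⁻¹ = ratio c₁ (-s₁) c₂ (-s₂) := by
  have := (one_add_pos h₁ n₁).ne'
  have := (one_sub_pos h₂ n₂).ne'
  unfold ratio
  rw [inv_div, div_eq_div_iff (by positivity) (by positivity)]
  linear_combination c₂ ^ 2 * h₁ + (1 - s₁ ^ 2) * h₂

include h₁ h₂ n₁ n₂ in
theorem ratio_sq : ratio c₁ s₁ c₂ s₂ ^ 2 = (1 + s₁) * (1 - s₂) / ((1 - s₁) * (1 + s₂)) := by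
  have := (one_add_pos h₂ n₂).ne'
  have := (one_sub_pos h₁ n₁).ne'
  unfold ratio
  rw [div_pow, div_eq_div_iff (by positivity) (by positivity)]
  linear_combination (-(1 + s₁) * (1 - s₂)) * (c₂ ^ 2 * h₁ + (1 - s₁ ^ 2) * h₂)

include h₁ h₂ n₁ n₂ in
theorem abs_ratio_lt_one (hd : s₁ < s₂) : |ratio c₁ s₁ c₂ s₂| < 1 := by
  have := one_add_pos h₂ n₂
  have := one_sub_pos h₁ n₁
  rw [← sq_lt_one_iff_abs_lt_one, ratio_sq h₁ h₂ n₁ n₂, div_lt_one (by positivity)]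
  linarith

include h₁ h₂ n₁ n₂ in
theorem amplitude_polePart_of_lt (hd : s₁ < s₂) (x : ℤ) :
    amplitude (polePart c₁ s₁ c₂ s₂) x
      = -((ratio c₁ s₁ c₂ s₂ ^ |x| : ℝ) : ℂ) := by
  have p := (one_add_pos h₂ n₂).ne'
  have q := (one_sub_pos h₁ n₁).ne'
  have hm : (2 / ((1 - s₁) * (1 + s₂)) : ℝ) ≠ 0 := by positivity
  have e1 : 1 - ratio c₁ s₁ c₂ s₂ ^ 2 = 2 / ((1 - s₁) * (1 + s₂)) * (s₂ - s₁) := by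
    rw [ratio_sq h₁ h₂ n₁ n₂]
    field_simp
    ring
  have e2 : 1 + ratio c₁ s₁ c₂ s₂ ^ 2 = 2 / ((1 - s₁) * (1 + s₂)) * (1 - s₁ * s₂) := by
    rw [ratio_sq h₁ h₂ n₁ n₂]
    field_simp
    ring
  have e3 : ratio c₁ s₁ c₂ s₂ = 2 / ((1 - s₁) * (1 + s₂)) * (c₁ * c₂ / 2) := by
    unfold ratio
    field_simp
    linear_combination (-c₂ ^ 2) * h₁ - (1 - s₁ ^ 2) * h₂
  generalize (2 / ((1 - s₁) * (1 + s₂)) : ℝ) = m at *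
  have key := amplitude_poisson (abs_ratio_lt_one h₁ h₂ n₁ n₂ hd) x
  have hx : (ratio c₁ s₁ c₂ s₂ ^ |x| : ℝ) = ratio c₁ s₁ c₂ s₂ ^ x.natAbs := by
    rw [← Int.natCast_natAbs, zpow_natCast]
  rw [hx, Complex.ofReal_pow, ← key, ← neg_one_mul, ← amplitude_const_mul]
  refine congrArg (amplitude · x) (funext fun k => ?_)
  have hmC : (m : ℂ) ≠ 0 := by exact_mod_cast hm
  have e1C : (1 - (ratio c₁ s₁ c₂ s₂ : ℂ) ^ 2) = m * (s₂ - s₁) := by exact_mod_cast e1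
  have e2C : (1 + (ratio c₁ s₁ c₂ s₂ : ℂ) ^ 2) = m * (1 - s₁ * s₂) := by exact_mod_cast e2
  have e3C : (ratio c₁ s₁ c₂ s₂ : ℂ) = m * (c₁ * c₂ / 2) := by exact_mod_cast e3
  have e4 : 1 - (ratio c₁ s₁ c₂ s₂ : ℂ) * (zeta k + (zeta k)⁻¹) + (ratio c₁ s₁ c₂ s₂ : ℂ) ^ 2
      = m * (1 - ((s₁ * s₂ : ℝ) : ℂ) - ((c₁ * c₂ : ℝ) : ℂ) * (zeta k + (zeta k)⁻¹) / 2) := by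
    push_cast
    linear_combination e2C - (zeta k + (zeta k)⁻¹) * e3C
  rw [polePart, e4, e1C, mul_div_mul_left _ _ hmC]
  push_cast
  ring

include h₁ h₂ n₁ n₂ in
/-- Partial fractions of the flat-band projection have the two denominators `1 ∓ cos ω`. Each of
them, normalised by `s₁ ∓ s₂`, has geometrically decaying Fourier coefficients. The normalisation
also covers `s₁ = ±s₂`, where the pole lies on the circle but its numerator vanishes. -/
theorem amplitude_polePart (x : ℤ) :
    amplitude (polePart c₁ s₁ c₂ s₂) x
      = (decayMode (ratio c₁ s₁ c₂ s₂) (s₁ - s₂) x : ℂ) := by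
  unfold decayMode
  rcases lt_trichotomy s₁ s₂ with hd | hd | hd
  · rw [amplitude_polePart_of_lt h₁ h₂ n₁ n₂ hd, if_pos (by linarith)]
    push_cast
    ring
  · simp [hd, amplitude, polePart]
  · rw [if_neg (by linarith), if_pos (by linarith), zpow_neg, ← inv_zpow,
      ratio_inv h₁ h₂ n₁ n₂]
    have key := amplitude_polePart_of_lt (c₁ := c₁) (s₁ := -s₁) (c₂ := c₂) (s₂ := -s₂)
      (by simpa using h₁) (by simpa using h₂) n₁ n₂ (by linarith) x
    rw [← neg_inj, ← key, ← neg_one_mul, ← amplitude_const_mul]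
    refine congrArg (amplitude · x) (funext fun k => ?_)
    simp only [polePart]
    push_cast
    ring

include h₁ h₂ n₁ n₂ in
/-- On `x ≥ 0` the contribution of one pole to `4 η₃` is a combination of a mode and its translate;
`third_coeff_neg` is the case `x < 0`. The translation switches between `|x| + 1` and `|x| - 1`,
which produces the different prefactors of the two half-lines. -/
theorem third_coeff_nonneg {x : ℤ} (hx : 0 ≤ x) :
    c₁ * ((s₁ - s₂) * (1 / (1 - s₁) * ratio c₁ s₁ c₂ s₂ ^ x * ind (s₁ < s₂)
        + 1 / (1 + s₁) * ratio c₁ s₁ c₂ s₂ ^ (-x) * ind (s₁ > s₂)))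
      = c₁ * decayMode (ratio c₁ s₁ c₂ s₂) (s₁ - s₂) x
        - c₂ * decayMode (ratio c₁ s₁ c₂ s₂) (s₁ - s₂) (x + 1) := by
  have p := (one_add_pos h₁ n₁).ne'
  have q := (one_sub_pos h₁ n₁).ne'
  have hr := ratio_ne_zero h₁ h₂ n₁ n₂
  unfold decayMode ind
  rw [abs_of_nonneg hx, abs_of_nonneg (by omega : 0 ≤ x + 1)]
  rcases lt_trichotomy s₁ s₂ with hd | hd | hd
  · rw [if_pos hd, if_neg (by linarith), if_pos (by linarith), if_pos (by linarith),
      zpow_add_one₀ hr]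
    have : c₁ * ((s₁ - s₂) / (1 - s₁)) = -c₁ + c₂ * ratio c₁ s₁ c₂ s₂ := by
      unfold ratio
      field_simp
      linear_combination (1 - s₂) * h₁
    linear_combination ratio c₁ s₁ c₂ s₂ ^ x * this
  · simp [hd]
  · rw [if_neg (by linarith), if_pos hd, if_neg (by linarith), if_pos (by linarith),
      if_neg (by linarith), if_pos (by linarith), neg_add, zpow_add₀ hr, zpow_neg_one,
      ratio_inv h₁ h₂ n₁ n₂]
    have : c₁ * ((s₁ - s₂) / (1 + s₁)) = c₁ - c₂ * ratio c₁ (-s₁) c₂ (-s₂) := by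
      unfold ratio
      field_simp
      linear_combination (-(1 + s₂)) * h₁
    linear_combination ratio c₁ s₁ c₂ s₂ ^ (-x) * this

include h₁ h₂ n₁ n₂ in
theorem third_coeff_neg {x : ℤ} (hx : ¬ 0 ≤ x) :
    -(c₁ * ((s₁ - s₂) * (1 / (1 + s₁) * ratio c₁ s₁ c₂ s₂ ^ (-x) * ind (s₁ < s₂)
        + 1 / (1 - s₁) * ratio c₁ s₁ c₂ s₂ ^ x * ind (s₁ > s₂))))
      = c₁ * decayMode (ratio c₁ s₁ c₂ s₂) (s₁ - s₂) x
        - c₂ * decayMode (ratio c₁ s₁ c₂ s₂) (s₁ - s₂) (x + 1) := by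
  have p := (one_add_pos h₁ n₁).ne'
  have q := (one_sub_pos h₁ n₁).ne'
  have hr := ratio_ne_zero h₁ h₂ n₁ n₂
  unfold decayMode ind
  rw [abs_of_neg (by omega : x < 0), abs_of_nonpos (by omega : x + 1 ≤ 0), neg_neg, neg_neg]
  rcases lt_trichotomy s₁ s₂ with hd | hd | hd
  · rw [if_pos hd, if_neg (by linarith), if_pos (by linarith), if_pos (by linarith),
      neg_add, zpow_add₀ hr, zpow_neg_one, ratio_inv h₁ h₂ n₁ n₂]
    have : c₁ * ((s₁ - s₂) / (1 + s₁)) = c₁ - c₂ * ratio c₁ (-s₁) c₂ (-s₂) := by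
      unfold ratio
      field_simp
      linear_combination (-(1 + s₂)) * h₁
    linear_combination (-ratio c₁ s₁ c₂ s₂ ^ (-x)) * this
  · simp [hd]
  · rw [if_neg (by linarith), if_pos hd, if_neg (by linarith), if_pos (by linarith),
      if_neg (by linarith), if_pos (by linarith), zpow_add_one₀ hr]
    have : c₁ * ((s₁ - s₂) / (1 - s₁)) = -c₁ + c₂ * ratio c₁ s₁ c₂ s₂ := by
      unfold ratio
      field_simp
      linear_combination (1 - s₂) * h₁
    linear_combination (-ratio c₁ s₁ c₂ s₂ ^ x) * this

include h₁ h₂ n₁ n₂ in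
/-- The analogue of `third_coeff_nonneg` for `4 η₂`. Each pole enters with the ratio of the other
pole, `ratio c₁ s₁ (-c₂) (-s₂)`. -/
theorem second_coeff_nonneg {x : ℤ} (hx : 0 ≤ x) :
    (s₁ - s₂) * (ratio c₁ s₁ (-c₂) (-s₂) * ratio c₁ s₁ c₂ s₂ ^ x * ind (s₁ < s₂)
        - (ratio c₁ s₁ (-c₂) (-s₂))⁻¹ * ratio c₁ s₁ c₂ s₂ ^ (-x) * ind (s₁ > s₂))
      = -(2 * s₂ * c₁ / c₂) * decayMode (ratio c₁ s₁ c₂ s₂) (s₁ - s₂) x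
        + (s₁ + s₂) * decayMode (ratio c₁ s₁ c₂ s₂) (s₁ - s₂) (x + 1) := by
  have hr := ratio_ne_zero h₁ h₂ n₁ n₂
  rw [ratio_inv h₁ (c₂ := -c₂) (s₂ := -s₂) (by simpa using h₂) n₁ (by simpa using n₂)]
  unfold decayMode ind
  rw [abs_of_nonneg hx, abs_of_nonneg (by omega : 0 ≤ x + 1)]
  rcases lt_trichotomy s₁ s₂ with hd | hd | hd
  · rw [if_pos hd, if_neg (by linarith), if_pos (by linarith), if_pos (by linarith),
      zpow_add_one₀ hr]
    have : (s₁ - s₂) * ratio c₁ s₁ (-c₂) (-s₂)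
        = 2 * s₂ * c₁ / c₂ - (s₁ + s₂) * ratio c₁ s₁ c₂ s₂ := by
      unfold ratio
      field_simp
      linear_combination (-2 * s₂) * h₁
    linear_combination ratio c₁ s₁ c₂ s₂ ^ x * this
  · simp [hd]
  · rw [if_neg (by linarith), if_pos hd, if_neg (by linarith), if_pos (by linarith),
      if_neg (by linarith), if_pos (by linarith), neg_add, zpow_add₀ hr, zpow_neg_one,
      ratio_inv h₁ h₂ n₁ n₂]
    have : (s₁ - s₂) * ratio c₁ (-s₁) (-c₂) (- -s₂)
        = 2 * s₂ * c₁ / c₂ - (s₁ + s₂) * ratio c₁ (-s₁) c₂ (-s₂) := by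
      unfold ratio
      field_simp
      linear_combination (-2 * s₂) * h₁
    linear_combination (-ratio c₁ s₁ c₂ s₂ ^ (-x)) * this

include h₁ h₂ n₁ n₂ in
theorem second_coeff_neg {x : ℤ} (hx : ¬ 0 ≤ x) :
    (s₁ - s₂) * ((ratio c₁ s₁ (-c₂) (-s₂))⁻¹ * ratio c₁ s₁ c₂ s₂ ^ (-x) * ind (s₁ < s₂)
        - ratio c₁ s₁ (-c₂) (-s₂) * ratio c₁ s₁ c₂ s₂ ^ x * ind (s₁ > s₂))
      = -(2 * s₂ * c₁ / c₂) * decayMode (ratio c₁ s₁ c₂ s₂) (s₁ - s₂) x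
        + (s₁ + s₂) * decayMode (ratio c₁ s₁ c₂ s₂) (s₁ - s₂) (x + 1) := by
  have hr := ratio_ne_zero h₁ h₂ n₁ n₂
  rw [ratio_inv h₁ (c₂ := -c₂) (s₂ := -s₂) (by simpa using h₂) n₁ (by simpa using n₂)]
  unfold decayMode ind
  rw [abs_of_neg (by omega : x < 0), abs_of_nonpos (by omega : x + 1 ≤ 0), neg_neg, neg_neg, neg_neg]
  rcases lt_trichotomy s₁ s₂ with hd | hd | hd
  · rw [if_pos hd, if_neg (by linarith), if_pos (by linarith), if_pos (by linarith),
      neg_add, zpow_add₀ hr, zpow_neg_one, ratio_inv h₁ h₂ n₁ n₂]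
    have : (s₁ - s₂) * ratio c₁ (-s₁) (-c₂) s₂
        = 2 * s₂ * c₁ / c₂ - (s₁ + s₂) * ratio c₁ (-s₁) c₂ (-s₂) := by
      unfold ratio
      field_simp
      linear_combination (-2 * s₂) * h₁
    linear_combination ratio c₁ s₁ c₂ s₂ ^ (-x) * this
  · simp [hd]
  · rw [if_neg (by linarith), if_pos hd, if_neg (by linarith), if_pos (by linarith),
      if_neg (by linarith), if_pos (by linarith), zpow_add_one₀ hr]
    have : (s₁ - s₂) * ratio c₁ s₁ (-c₂) (-s₂)
        = 2 * s₂ * c₁ / c₂ - (s₁ + s₂) * ratio c₁ s₁ c₂ s₂ := by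
      unfold ratio
      field_simp
      linear_combination (-2 * s₂) * h₁
    linear_combination (-ratio c₁ s₁ c₂ s₂ ^ x) * this

end

/-! ### The coefficients `η₁`, `η₂`, `η₃` in terms of the modes -/

/-- The decaying mode of the pole `cos ω = 1`. -/
def mode₁ (θ₁ θ₂ : ℝ) (x : ℤ) : ℝ :=
  decayMode (ν₁ θ₁ θ₂) (Real.sin θ₁ - Real.sin θ₂) x

/-- The decaying mode of the pole `cos ω = -1`. -/
def mode₂ (θ₁ θ₂ : ℝ) (x : ℤ) : ℝ :=
  decayMode (ν₂ θ₁ θ₂) (Real.sin θ₁ + Real.sin θ₂) x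

theorem ν₁_eq (θ₁ θ₂ : ℝ) :
    ν₁ θ₁ θ₂ = ratio (Real.cos θ₁) (Real.sin θ₁) (Real.cos θ₂) (Real.sin θ₂) := rfl

theorem ν₂_eq (θ₁ θ₂ : ℝ) :
    ν₂ θ₁ θ₂ = ratio (Real.cos θ₁) (Real.sin θ₁) (-Real.cos θ₂) (-Real.sin θ₂) := by
  rw [ν₂, ratio, sub_neg_eq_add, mul_neg, div_neg]

theorem decayMode_neg (r d : ℝ) (x : ℤ) : decayMode r d (-x) = decayMode r d x := by
  rw [decayMode, abs_neg, decayMode]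

theorem mode₁_neg (θ₁ θ₂ : ℝ) (x : ℤ) : mode₁ θ₁ θ₂ (-x) = mode₁ θ₁ θ₂ x := decayMode_neg _ _ x

theorem mode₂_neg (θ₁ θ₂ : ℝ) (x : ℤ) : mode₂ θ₁ θ₂ (-x) = mode₂ θ₁ θ₂ x := decayMode_neg _ _ x

section
variable {θ₁ θ₂ : ℝ}

theorem decayMode_eq (r a b : ℝ) (x : ℤ) :
    decayMode r (a - b) x = -(r ^ |x| * ind (a < b) - r ^ (-|x|) * ind (a > b)) := by
  unfold decayMode ind
  simp only [sub_neg, sub_pos, gt_iff_lt]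
  split_ifs <;> linarith

theorem η₁_eq (x : ℤ) :
    η₁ θ₁ θ₂ x = ((Real.sin θ₁ - Real.sin θ₂) * mode₁ θ₁ θ₂ x
      + (Real.sin θ₁ + Real.sin θ₂) * mode₂ θ₁ θ₂ x) / 4 := by
  have h := decayMode_eq (ν₂ θ₁ θ₂) (Real.sin θ₁) (-Real.sin θ₂) x
  rw [sub_neg_eq_add] at h
  rw [mode₁, mode₂, h, decayMode_eq, η₁]
  ring

variable (n₁ : Real.cos θ₁ ≠ 0) (n₂ : Real.cos θ₂ ≠ 0)

include n₁ n₂ in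
theorem η₂_eq (x : ℤ) :
    η₂ θ₁ θ₂ x = (-(2 * Real.sin θ₂ * Real.cos θ₁ / Real.cos θ₂)
        * (mode₁ θ₁ θ₂ x + mode₂ θ₁ θ₂ x)
      + (Real.sin θ₁ + Real.sin θ₂) * mode₁ θ₁ θ₂ (x + 1)
      + (Real.sin θ₁ - Real.sin θ₂) * mode₂ θ₁ θ₂ (x + 1)) / 4 := by
  have h₁ := Real.cos_sq_add_sin_sq θ₁
  have h₂ := Real.cos_sq_add_sin_sq θ₂
  have h₂' : (-Real.cos θ₂) ^ 2 + (-Real.sin θ₂) ^ 2 = 1 := by rw [neg_sq, neg_sq, h₂]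
  have n₂' : -Real.cos θ₂ ≠ 0 := by simpa using n₂
  unfold η₂ mode₁ mode₂
  by_cases hx : 0 ≤ x
  · have A := second_coeff_nonneg h₁ h₂ n₁ n₂ hx
    have B := second_coeff_nonneg h₁ h₂' n₁ n₂' hx
    simp only [neg_neg, sub_neg_eq_add, ← ν₁_eq, ← ν₂_eq] at A B
    simp only [if_pos hx]
    rw [A, B]
    field_simp
    ring
  · have A := second_coeff_neg h₁ h₂ n₁ n₂ hx
    have B := second_coeff_neg h₁ h₂' n₁ n₂' hx
    simp only [neg_neg, sub_neg_eq_add, ← ν₁_eq, ← ν₂_eq] at A B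
    simp only [if_neg hx]
    rw [A, B]
    field_simp
    ring

include n₁ n₂ in
theorem η₃_eq (x : ℤ) :
    η₃ θ₁ θ₂ x = (Real.cos θ₁ * (mode₁ θ₁ θ₂ x + mode₂ θ₁ θ₂ x)
      - Real.cos θ₂ * (mode₁ θ₁ θ₂ (x + 1) - mode₂ θ₁ θ₂ (x + 1))) / 4 := by
  have h₁ := Real.cos_sq_add_sin_sq θ₁
  have h₂ := Real.cos_sq_add_sin_sq θ₂
  have h₂' : (-Real.cos θ₂) ^ 2 + (-Real.sin θ₂) ^ 2 = 1 := by rw [neg_sq, neg_sq, h₂]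
  have n₂' : -Real.cos θ₂ ≠ 0 := by simpa using n₂
  unfold η₃ mode₁ mode₂
  by_cases hx : 0 ≤ x
  · have A := third_coeff_nonneg h₁ h₂ n₁ n₂ hx
    have B := third_coeff_nonneg h₁ h₂' n₁ n₂' hx
    simp only [sub_neg_eq_add, ← ν₁_eq, ← ν₂_eq] at A B
    simp only [if_pos hx]
    linear_combination (A + B) / 4
  · have A := third_coeff_neg h₁ h₂ n₁ n₂ hx
    have B := third_coeff_neg h₁ h₂' n₁ n₂' hx
    simp only [sub_neg_eq_add, ← ν₁_eq, ← ν₂_eq] at A B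
    simp only [if_neg hx]
    linear_combination (A + B) / 4

end

/-! ### The one-qubit factors of a time step -/

/-- The half-trace `cos ω(k) = c₁ c₂ cos k + s₁ s₂` of the one-qubit factors. -/
def cosOmega (θ₁ θ₂ k : ℝ) : ℝ :=
  Real.cos θ₁ * Real.cos θ₂ * Real.cos k + Real.sin θ₁ * Real.sin θ₂

/-- The dispersion relation: the one-qubit factors have eigenvalues `e^{± i ω(k)}`. -/
def omega (θ₁ θ₂ k : ℝ) : ℝ := Real.arccos (cosOmega θ₁ θ₂ k)

/-- The one-qubit factor `D U₁ D U₂` with `D = diag(e^{ik/2}, e^{-ik/2})`; the product `D U₁ D` has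
no half-integer powers. -/
def factor (θ₁ θ₂ k : ℝ) : Matrix (Fin 2) (Fin 2) ℂ :=
  !![zeta k * Real.cos θ₁, Real.sin θ₁; Real.sin θ₁, -((zeta k)⁻¹ * Real.cos θ₁)] * U θ₂

/-- The trace-free part of `factor`. -/
def tracefree (θ₁ θ₂ k : ℝ) : Matrix (Fin 2) (Fin 2) ℂ :=
  !![Real.cos θ₁ * Real.cos θ₂ * (zeta k - (zeta k)⁻¹) / 2,
      zeta k * Real.cos θ₁ * Real.sin θ₂ - Real.sin θ₁ * Real.cos θ₂;
    Real.sin θ₁ * Real.cos θ₂ - (zeta k)⁻¹ * Real.cos θ₁ * Real.sin θ₂,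
      -(Real.cos θ₁ * Real.cos θ₂ * (zeta k - (zeta k)⁻¹) / 2)]

/-- The normalised trace-free part, a complex structure (`J² = -1`) where `sin ω ≠ 0`, so that
`factor = cos ω + sin ω J`. -/
def axis (θ₁ θ₂ k : ℝ) : Matrix (Fin 2) (Fin 2) ℂ :=
  ((Real.sin (omega θ₁ θ₂ k) : ℝ) : ℂ)⁻¹ • tracefree θ₁ θ₂ k

theorem cosOmega_comm (θ₁ θ₂ k : ℝ) : cosOmega θ₂ θ₁ k = cosOmega θ₁ θ₂ k := by
  unfold cosOmega
  ring

theorem omega_comm (θ₁ θ₂ k : ℝ) : omega θ₂ θ₁ k = omega θ₁ θ₂ k := by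
  rw [omega, cosOmega_comm, omega]

theorem cosOmega_eq (θ₁ θ₂ k : ℝ) : (cosOmega θ₁ θ₂ k : ℂ)
    = Real.cos θ₁ * Real.cos θ₂ * (zeta k + (zeta k)⁻¹) / 2 + Real.sin θ₁ * Real.sin θ₂ := by
  rw [cosOmega, zeta_inv_eq, zeta_eq]
  push_cast
  ring

theorem one_sub_cosOmega_sq (θ₁ θ₂ k : ℝ) : 1 - cosOmega θ₁ θ₂ k ^ 2
    = (Real.cos θ₁ * Real.cos θ₂ * Real.sin k) ^ 2
      + ((Real.cos θ₁ * Real.sin θ₂ * Real.cos k - Real.sin θ₁ * Real.cos θ₂) ^ 2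
        + (Real.cos θ₁ * Real.sin θ₂ * Real.sin k) ^ 2) := by
  have h₁ := Real.cos_sq_add_sin_sq θ₁
  have h₂ := Real.cos_sq_add_sin_sq θ₂
  have h₃ := Real.cos_sq_add_sin_sq k
  unfold cosOmega
  grind

theorem sin_omega (θ₁ θ₂ k : ℝ) :
    Real.sin (omega θ₁ θ₂ k) = √(1 - cosOmega θ₁ θ₂ k ^ 2) := Real.sin_arccos _

theorem one_sub_cosOmega_sq_nonneg (θ₁ θ₂ k : ℝ) : 0 ≤ 1 - cosOmega θ₁ θ₂ k ^ 2 := by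
  rw [one_sub_cosOmega_sq]
  positivity

theorem sin_omega_sq (θ₁ θ₂ k : ℝ) :
    Real.sin (omega θ₁ θ₂ k) ^ 2 = 1 - cosOmega θ₁ θ₂ k ^ 2 := by
  rw [sin_omega, Real.sq_sqrt (one_sub_cosOmega_sq_nonneg θ₁ θ₂ k)]

theorem cos_omega (θ₁ θ₂ k : ℝ) : Real.cos (omega θ₁ θ₂ k) = cosOmega θ₁ θ₂ k := by
  have h := abs_le.1 (abs_le_one_iff_mul_self_le_one.2
    (by linarith [one_sub_cosOmega_sq_nonneg θ₁ θ₂ k] : cosOmega θ₁ θ₂ k * cosOmega θ₁ θ₂ k ≤ 1))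
  exact Real.cos_arccos h.1 h.2

theorem sin_ne_zero_of_mem {k : ℝ} (hk : k ∈ Set.Ioo (-Real.pi) Real.pi) (h0 : k ≠ 0) :
    Real.sin k ≠ 0 := fun h => h0 ((Real.sin_eq_zero_iff_of_lt_of_lt hk.1 hk.2).1 h)

theorem sin_omega_pos {θ₁ θ₂ k : ℝ} (n₁ : Real.cos θ₁ ≠ 0) (n₂ : Real.cos θ₂ ≠ 0)
    (hk : Real.sin k ≠ 0) : 0 < Real.sin (omega θ₁ θ₂ k) := by
  rw [sin_omega, one_sub_cosOmega_sq]
  positivity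

theorem factor_eq (θ₁ θ₂ k : ℝ) :
    factor θ₁ θ₂ k = (cosOmega θ₁ θ₂ k : ℂ) • 1 + tracefree θ₁ θ₂ k := by
  rw [cosOmega_eq]
  ext i j
  fin_cases i <;> fin_cases j <;> simp [factor, tracefree, U] <;> ring

theorem tracefree_mul_self (θ₁ θ₂ k : ℝ) :
    tracefree θ₁ θ₂ k * tracefree θ₁ θ₂ k = -((1 - (cosOmega θ₁ θ₂ k : ℂ) ^ 2) • 1) := by
  have h₁ : ((Real.cos θ₁ : ℝ) : ℂ) ^ 2 + ((Real.sin θ₁ : ℝ) : ℂ) ^ 2 = 1 := by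
    exact_mod_cast Real.cos_sq_add_sin_sq θ₁
  have h₂ : ((Real.cos θ₂ : ℝ) : ℂ) ^ 2 + ((Real.sin θ₂ : ℝ) : ℂ) ^ 2 = 1 := by
    exact_mod_cast Real.cos_sq_add_sin_sq θ₂
  have hz := mul_inv_cancel₀ (zeta_ne_zero k)
  rw [cosOmega_eq, tracefree]
  generalize zeta k = z, ((Real.cos θ₁ : ℝ) : ℂ) = c₁, ((Real.sin θ₁ : ℝ) : ℂ) = s₁,
    ((Real.cos θ₂ : ℝ) : ℂ) = c₂, ((Real.sin θ₂ : ℝ) : ℂ) = s₂ at *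
  ext i j
  fin_cases i <;> fin_cases j <;> simp [Matrix.mul_apply, Fin.sum_univ_two] <;>
    first
    | ring1
    | linear_combination (-c₁ ^ 2 * (c₂ ^ 2 + s₂ ^ 2)) * hz - (c₁ ^ 2 + s₁ ^ 2) * h₂ - h₁

theorem axis_mul_self {θ₁ θ₂ k : ℝ} (h : Real.sin (omega θ₁ θ₂ k) ≠ 0) :
    axis θ₁ θ₂ k * axis θ₁ θ₂ k = -1 := by
  have hs : ((Real.sin (omega θ₁ θ₂ k) : ℝ) : ℂ) ≠ 0 := by exact_mod_cast h
  have e : 1 - (cosOmega θ₁ θ₂ k : ℂ) ^ 2 = ((Real.sin (omega θ₁ θ₂ k) : ℝ) : ℂ) ^ 2 := by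
    exact_mod_cast (sin_omega_sq θ₁ θ₂ k).symm
  rw [axis, smul_mul_smul_comm, tracefree_mul_self, e, smul_neg, smul_smul]
  rw [show (((Real.sin (omega θ₁ θ₂ k) : ℝ) : ℂ)⁻¹ * ((Real.sin (omega θ₁ θ₂ k) : ℝ) : ℂ)⁻¹
    * ((Real.sin (omega θ₁ θ₂ k) : ℝ) : ℂ) ^ 2) = 1 by field_simp, one_smul]

theorem factor_pow {θ₁ θ₂ k : ℝ} (h : Real.sin (omega θ₁ θ₂ k) ≠ 0) (t : ℕ) :
    factor θ₁ θ₂ k ^ t = ((Real.cos (t * omega θ₁ θ₂ k) : ℝ) : ℂ) • 1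
      + ((Real.sin (t * omega θ₁ θ₂ k) : ℝ) : ℂ) • axis θ₁ θ₂ k := by
  have hs : ((Real.sin (omega θ₁ θ₂ k) : ℝ) : ℂ) ≠ 0 := by exact_mod_cast h
  have e : factor θ₁ θ₂ k = ((Real.cos (omega θ₁ θ₂ k) : ℝ) : ℂ) • 1
      + ((Real.sin (omega θ₁ θ₂ k) : ℝ) : ℂ) • axis θ₁ θ₂ k := by
    rw [factor_eq, cos_omega, axis, smul_smul, mul_inv_cancel₀ hs, one_smul]
  induction t with
  | zero => simp
  | succ t ih =>
    rw [pow_succ, ih, e]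
    simp only [add_mul, mul_add, smul_mul_smul_comm, axis_mul_self h, one_mul, mul_one]
    push_cast
    rw [add_mul, one_mul, Complex.cos_add, Complex.sin_add]
    module

/-! ### The walk in momentum space -/

theorem coinFlip_amplitude (M : Matrix Coin Coin ℂ) {F : Coin → ℝ → ℂ}
    (hF : ∀ j, Continuous (F j)) :
    coinFlip M (fun x j => amplitude (F j) x)
      = fun x j => amplitude (fun k => ∑ i, M j i * F i k) x := by
  funext x j
  rw [amplitude_sum (f := fun i k => M j i * F i k) _
    fun i _ => (continuous_const.mul (hF i)).intervalIntegrable _ _]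
  simp only [amplitude_const_mul]
  rfl

theorem opS_amplitude (F : Coin → ℝ → ℂ) :
    opS (fun x j => amplitude (F j) x)
      = fun x j => amplitude (fun k => zeta k ^ (-disp j) * F j k) x := by
  funext x j
  rw [amplitude_zeta_mul]
  rfl

theorem continuous_factor_apply (θ₁ θ₂ : ℝ) (i j : Fin 2) :
    Continuous fun k => factor θ₁ θ₂ k i j := by
  have h1 : Continuous zeta := by simpa using continuous_zeta_zpow 1
  have h2 : Continuous fun k => (zeta k)⁻¹ := by simpa using continuous_zeta_zpow (-1)
  fin_cases i <;> fin_cases j <;> simp [factor, U] <;> fun_prop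

/-- One time step at momentum `k`. -/
def stepMatrix (θ₁ θ₂ k : ℝ) : Matrix Coin Coin ℂ := factor θ₁ θ₂ k ⊗ₖ factor θ₂ θ₁ k

theorem step_amplitude (θ₁ θ₂ : ℝ) {F : Coin → ℝ → ℂ} (hF : ∀ j, Continuous (F j)) :
    (opS * opY θ₁ θ₂ * opS * opX θ₁ θ₂) (fun x j => amplitude (F j) x)
      = fun x j => amplitude (fun k => ∑ i, stepMatrix θ₁ θ₂ k j i * F i k) x := by
  simp only [Module.End.mul_apply, opX, opY]
  rw [coinFlip_amplitude _ hF, opS_amplitude, coinFlip_amplitude, opS_amplitude]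
  · funext x j
    refine congrArg (amplitude · x) (funext fun k => ?_)
    obtain ⟨j₁, j₂⟩ := j
    have hz := zeta_ne_zero k
    fin_cases j₁ <;> fin_cases j₂ <;>
      simp [Fintype.sum_prod_type, Matrix.kroneckerMap_apply, stepMatrix, factor, disp, U] <;>
      field_simp <;> ring
  · exact fun j => (continuous_zeta_zpow _).mul
      (continuous_finsetSum _ fun i _ => continuous_const.mul (hF i))

theorem continuous_stepMatrix_pow (θ₁ θ₂ : ℝ) (t : ℕ) (i j : Coin) :
    Continuous fun k => (stepMatrix θ₁ θ₂ k ^ t) i j := by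
  induction t generalizing i j with
  | zero => simpa using continuous_const
  | succ t ih =>
    simp only [pow_succ, Matrix.mul_apply]
    exact continuous_finsetSum _ fun l _ => (ih i l).mul
      ((continuous_factor_apply _ _ _ _).mul (continuous_factor_apply _ _ _ _))

theorem state_eq_amplitude (θ₁ θ₂ : ℝ) (q₀ q₁ q₂ q₃ : ℂ) (t : ℕ) (x : ℤ) (j : Coin) :
    state θ₁ θ₂ q₀ q₁ q₂ q₃ t x j = ∑ i : Coin,
      amplitude (fun k => (stepMatrix θ₁ θ₂ k ^ t) j i) x * !![q₀, q₁; q₂, q₃] i.1 i.2 := by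
  have hc : ∀ (t : ℕ) (j : Coin), Continuous fun k =>
      ∑ i : Coin, !![q₀, q₁; q₂, q₃] i.1 i.2 * (stepMatrix θ₁ θ₂ k ^ t) j i := fun t j =>
    continuous_finsetSum _ fun i _ => continuous_const.mul (continuous_stepMatrix_pow _ _ t j i)
  have key : state θ₁ θ₂ q₀ q₁ q₂ q₃ t = fun x j => amplitude (fun k =>
      ∑ i : Coin, !![q₀, q₁; q₂, q₃] i.1 i.2 * (stepMatrix θ₁ θ₂ k ^ t) j i) x := by
    induction t with
    | zero =>
      funext x j
      simp only [state, pow_zero, Module.End.one_apply, initial, Matrix.one_apply, mul_ite, mul_one,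
        mul_zero, Finset.sum_ite_eq, Finset.mem_univ, if_true]
      have := amplitude_const_mul (!![q₀, q₁; q₂, q₃] j.1 j.2) (fun _ => 1) x
      rw [amplitude_one] at this
      simpa using this.symm
    | succ t ih =>
      have e : state θ₁ θ₂ q₀ q₁ q₂ q₃ (t + 1)
          = (opS * opY θ₁ θ₂ * opS * opX θ₁ θ₂) (state θ₁ θ₂ q₀ q₁ q₂ q₃ t) := by
        rw [state, pow_succ', Module.End.mul_apply, state]
      rw [e, ih, step_amplitude θ₁ θ₂ (hc t)]
      funext x j
      refine congrArg (amplitude · x) (funext fun k => ?_)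
      simp only [pow_succ', Matrix.mul_apply, Finset.mul_sum]
      rw [Finset.sum_comm]
      exact Finset.sum_congr rfl fun _ _ => Finset.sum_congr rfl fun _ _ => by ring
  rw [key]
  simp only
  rw [amplitude_sum
    (f := fun i k => !![q₀, q₁; q₂, q₃] i.1 i.2 * (stepMatrix θ₁ θ₂ k ^ t) j i) _ fun i _ =>
    (continuous_const.mul (continuous_stepMatrix_pow _ _ t j i)).intervalIntegrable _ _]
  simp only [amplitude_const_mul]
  exact Finset.sum_congr rfl fun _ _ => mul_comm _ _

/-! ### Dispersion and decay -/

theorem continuous_omega (θ₁ θ₂ : ℝ) : Continuous (omega θ₁ θ₂) := by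
  unfold omega cosOmega
  exact Real.continuous_arccos.comp (by fun_prop)

theorem continuous_zeta : Continuous zeta := by simpa using continuous_zeta_zpow 1

theorem continuous_zeta_inv : Continuous fun k => (zeta k)⁻¹ := by
  simpa using continuous_zeta_zpow (-1)

section
variable {θ₁ θ₂ : ℝ} (n₁ : Real.cos θ₁ ≠ 0) (n₂ : Real.cos θ₂ ≠ 0)

include n₁ n₂ in
theorem hasDerivAt_omega {k : ℝ} (hk : Real.sin k ≠ 0) :
    HasDerivAt (omega θ₁ θ₂)
      (Real.cos θ₁ * Real.cos θ₂ * Real.sin k / Real.sin (omega θ₁ θ₂ k)) k := by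
  have hs := sin_omega_pos n₁ n₂ hk
  have hsq := sin_omega_sq θ₁ θ₂ k
  have hpos : 0 < 1 - cosOmega θ₁ θ₂ k ^ 2 := hsq ▸ pow_pos hs 2
  have hc : HasDerivAt (cosOmega θ₁ θ₂) (Real.cos θ₁ * Real.cos θ₂ * -Real.sin k) k :=
    ((Real.hasDerivAt_cos k).const_mul _).add_const _
  have := (Real.hasDerivAt_arccos (x := cosOmega θ₁ θ₂ k) (fun h => by norm_num [h] at hpos)
    (fun h => by norm_num [h] at hpos)).comp k hc
  have e : Real.cos θ₁ * Real.cos θ₂ * Real.sin k / Real.sin (omega θ₁ θ₂ k)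
      = -(1 / √(1 - cosOmega θ₁ θ₂ k ^ 2)) * (Real.cos θ₁ * Real.cos θ₂ * -Real.sin k) := by
    rw [sin_omega]
    ring
  rw [e]
  exact this

include n₁ n₂ in
theorem cos_eq_of_omega_eq {a b : ℝ} (h : omega θ₁ θ₂ a = omega θ₁ θ₂ b) :
    Real.cos a = Real.cos b := by
  have h' := congrArg Real.cos h
  rw [cos_omega, cos_omega, cosOmega, cosOmega] at h'
  exact mul_left_cancel₀ (mul_ne_zero n₁ n₂) (by linarith)

include n₁ n₂ in
/-- On each half-period the dispersion relation is strictly monotone, so it can be taken as the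
integration variable; the Riemann-Lebesgue lemma then applies. -/
theorem tendsto_amplitude_exp {p : ℝ → ℂ} (hp : PeriodIntegrable p) (x : ℤ) :
    Tendsto (fun τ : ℝ => amplitude (fun k => Complex.exp (τ * omega θ₁ θ₂ k * Complex.I) * p k) x)
      (cocompact ℝ) (𝓝 0) := by
  have hπ := Real.pi_pos
  have half : ∀ s : Set ℝ, MeasurableSet s → (∀ k ∈ s, Real.sin k ≠ 0) → Set.InjOn Real.cos s →
      Tendsto (fun τ : ℝ => ∫ k in s,
        Complex.exp (τ * omega θ₁ θ₂ k * Complex.I) * (zeta k ^ x * p k)) (cocompact ℝ) (𝓝 0) := by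
    intro s hs hsin hinj
    refine tendsto_setIntegral_exp_phase hs
      (fun k hk => (hasDerivAt_omega n₁ n₂ (hsin k hk)).hasDerivWithinAt)
      (fun k hk => div_ne_zero (mul_ne_zero (mul_ne_zero n₁ n₂) (hsin k hk))
        (sin_omega_pos n₁ n₂ (hsin k hk)).ne')
      (fun a ha b hb h => hinj ha hb (cos_eq_of_omega_eq n₁ n₂ h)) _
  have hl := half (Set.Ioo (-Real.pi) 0) measurableSet_Ioo
    (fun k hk => sin_ne_zero_of_mem ⟨hk.1, by linarith [hk.2]⟩ hk.2.ne) (fun a ha b hb h => by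
      have : -a = -b := Real.injOn_cos ⟨by linarith [ha.2], by linarith [ha.1]⟩
        ⟨by linarith [hb.2], by linarith [hb.1]⟩ (by simpa using h)
      linarith)
  have hr := half (Set.Ioo 0 Real.pi) measurableSet_Ioo
    (fun k hk => sin_ne_zero_of_mem ⟨by linarith [hk.1], hk.2⟩ hk.1.ne')
    (Real.injOn_cos.mono Set.Ioo_subset_Icc_self)
  have key := (hl.add hr).const_mul (2 * Real.pi : ℂ)⁻¹
  rw [add_zero, mul_zero] at key
  refine key.congr fun τ => ?_
  have hexp : Continuous fun k : ℝ => Complex.exp (τ * omega θ₁ θ₂ k * Complex.I) := by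
    have := continuous_omega θ₁ θ₂
    fun_prop
  have hint : IntervalIntegrable (fun k => Complex.exp (τ * omega θ₁ θ₂ k * Complex.I) *
      (zeta k ^ x * p k)) volume (-Real.pi) Real.pi :=
    (hp.zeta_mul x).continuousOn_mul hexp.continuousOn
  rw [amplitude, ← integral_Ioc_eq_integral_Ioo, ← integral_Ioc_eq_integral_Ioo,
    ← intervalIntegral.integral_of_le (by linarith), ← intervalIntegral.integral_of_le hπ.le,
    intervalIntegral.integral_add_adjacent_intervals]
  · simp only [mul_left_comm]
  · exact hint.mono_set (Set.uIcc_subset_uIcc_left ⟨by simp [hπ.le], by simp [hπ.le]⟩)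
  · exact hint.mono_set (Set.uIcc_subset_uIcc_right ⟨by simp [hπ.le], by simp [hπ.le]⟩)

end

/-- Bounded measurable momentum profiles. -/
def IsBddProfile (f : ℝ → ℂ) : Prop := Measurable f ∧ ∃ C, ∀ k, ‖f k‖ ≤ C

namespace IsBddProfile
variable {f g : ℝ → ℂ}

theorem const (a : ℂ) : IsBddProfile fun _ => a := ⟨measurable_const, ‖a‖, fun _ => le_rfl⟩

theorem add (hf : IsBddProfile f) (hg : IsBddProfile g) : IsBddProfile fun k => f k + g k := by
  obtain ⟨mf, C, hC⟩ := hf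
  obtain ⟨mg, D, hD⟩ := hg
  exact ⟨mf.add mg, C + D, fun k => (norm_add_le _ _).trans (add_le_add (hC k) (hD k))⟩

theorem mul (hf : IsBddProfile f) (hg : IsBddProfile g) : IsBddProfile fun k => f k * g k := by
  obtain ⟨mf, C, hC⟩ := hf
  obtain ⟨mg, D, hD⟩ := hg
  exact ⟨mf.mul mg, C * D, fun k => (norm_mul_le _ _).trans
    (mul_le_mul (hC k) (hD k) (norm_nonneg _) ((norm_nonneg _).trans (hC k)))⟩

theorem periodIntegrable (hf : IsBddProfile f) : PeriodIntegrable f := by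
  obtain ⟨mf, C, hC⟩ := hf
  exact (intervalIntegrable_const (c := C)).mono_fun' mf.aestronglyMeasurable
    (.of_forall fun k => hC k)

end IsBddProfile

theorem norm_tracefree_apply_le (θ₁ θ₂ k : ℝ) (i j : Fin 2) :
    ‖tracefree θ₁ θ₂ k i j‖ ≤ Real.sin (omega θ₁ θ₂ k) := by
  rw [sin_omega]
  refine Real.le_sqrt_of_sq_le ?_
  rw [one_sub_cosOmega_sq]
  have e1 : (Real.cos θ₁ * Real.cos θ₂ * (zeta k - (zeta k)⁻¹) / 2 : ℂ)
      = ((0 : ℝ) : ℂ) + (Real.cos θ₁ * Real.cos θ₂ * Real.sin k : ℝ) * Complex.I := by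
    rw [zeta_inv_eq, zeta_eq]
    push_cast
    ring
  have e2 : (zeta k * Real.cos θ₁ * Real.sin θ₂ - Real.sin θ₁ * Real.cos θ₂ : ℂ)
      = ((Real.cos θ₁ * Real.sin θ₂ * Real.cos k - Real.sin θ₁ * Real.cos θ₂ : ℝ) : ℂ)
        + (Real.cos θ₁ * Real.sin θ₂ * Real.sin k : ℝ) * Complex.I := by
    rw [zeta_eq]
    push_cast
    ring
  have e3 : (Real.sin θ₁ * Real.cos θ₂ - (zeta k)⁻¹ * Real.cos θ₁ * Real.sin θ₂ : ℂ)
      = ((-(Real.cos θ₁ * Real.sin θ₂ * Real.cos k - Real.sin θ₁ * Real.cos θ₂) : ℝ) : ℂ)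
        + (Real.cos θ₁ * Real.sin θ₂ * Real.sin k : ℝ) * Complex.I := by
    rw [zeta_inv_eq]
    push_cast
    ring
  have hn : ∀ a b : ℝ, ‖(a + b * Complex.I : ℂ)‖ ^ 2 = a ^ 2 + b ^ 2 := fun a b => by
    rw [← Complex.normSq_eq_norm_sq, Complex.normSq_add_mul_I]
  fin_cases i <;> fin_cases j <;>
    simp only [tracefree, Fin.zero_eta, Fin.mk_one, Matrix.of_apply, Matrix.cons_val', Matrix.cons_val_zero,
      Matrix.cons_val_one, Matrix.cons_val_fin_one, norm_neg]
  · rw [e1, hn]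
    nlinarith [sq_nonneg (Real.cos θ₁ * Real.sin θ₂ * Real.cos k - Real.sin θ₁ * Real.cos θ₂),
      sq_nonneg (Real.cos θ₁ * Real.sin θ₂ * Real.sin k)]
  · rw [e2, hn]
    nlinarith [sq_nonneg (Real.cos θ₁ * Real.cos θ₂ * Real.sin k)]
  · rw [e3, hn]
    nlinarith [sq_nonneg (Real.cos θ₁ * Real.cos θ₂ * Real.sin k)]
  · rw [e1, hn]
    nlinarith [sq_nonneg (Real.cos θ₁ * Real.sin θ₂ * Real.cos k - Real.sin θ₁ * Real.cos θ₂),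
      sq_nonneg (Real.cos θ₁ * Real.sin θ₂ * Real.sin k)]

theorem isBddProfile_axis (θ₁ θ₂ : ℝ) (i j : Fin 2) :
    IsBddProfile fun k => axis θ₁ θ₂ k i j := by
  refine ⟨?_, 1, fun k => ?_⟩
  · simp only [axis, Matrix.smul_apply, smul_eq_mul]
    refine Measurable.mul ?_ ?_
    · have := (continuous_omega θ₁ θ₂).measurable
      fun_prop
    · have h1 := continuous_zeta
      have h2 := continuous_zeta_inv
      refine Continuous.measurable ?_
      fin_cases i <;> fin_cases j <;> simp [tracefree] <;> fun_prop
  · have h := norm_tracefree_apply_le θ₁ θ₂ k i j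
    simp only [axis, Matrix.smul_apply, smul_eq_mul]
    rw [norm_mul, norm_inv, Complex.norm_real,
      Real.norm_of_nonneg ((norm_nonneg _).trans h)]
    exact inv_mul_le_one_of_le₀ h ((norm_nonneg _).trans h)

/-! ### Splitting off the flat band -/

/-- The entries of the projection `(1 + J ⊗ J') / 2` onto the flat band, the eigenspace of
`stepMatrix` for the eigenvalue `1`. -/
def flatBand (θ₁ θ₂ : ℝ) (i j : Coin) (k : ℝ) : ℂ :=
  ((1 : Matrix (Fin 2) (Fin 2) ℂ) i.1 j.1 * (1 : Matrix (Fin 2) (Fin 2) ℂ) i.2 j.2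
    + axis θ₁ θ₂ k i.1 j.1 * axis θ₂ θ₁ k i.2 j.2) / 2

theorem stepMatrix_pow (θ₁ θ₂ k : ℝ) (t : ℕ) :
    stepMatrix θ₁ θ₂ k ^ t = (factor θ₁ θ₂ k ^ t) ⊗ₖ (factor θ₂ θ₁ k ^ t) := by
  induction t with
  | zero => simp
  | succ t ih => rw [pow_succ, pow_succ, pow_succ, ih, stepMatrix, Matrix.mul_kronecker_mul]

/-- For `σ = ±1`, the spectral projection `¼ (1 - iσJ) ⊗ (1 - iσJ')` of `stepMatrix` for the
eigenvalue `e^{2iσω}`. -/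
def rotatingBand (σ : ℂ) (θ₁ θ₂ : ℝ) (i j : Coin) (k : ℝ) : ℂ :=
  4⁻¹ * ((1 : Matrix (Fin 2) (Fin 2) ℂ) i.1 j.1 * (1 : Matrix (Fin 2) (Fin 2) ℂ) i.2 j.2
    + (-1) * (axis θ₁ θ₂ k i.1 j.1 * axis θ₂ θ₁ k i.2 j.2)
    + (-σ * Complex.I) * (axis θ₁ θ₂ k i.1 j.1 * (1 : Matrix (Fin 2) (Fin 2) ℂ) i.2 j.2
      + (1 : Matrix (Fin 2) (Fin 2) ℂ) i.1 j.1 * axis θ₂ θ₁ k i.2 j.2))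

theorem isBddProfile_flatBand (θ₁ θ₂ : ℝ) (i j : Coin) : IsBddProfile (flatBand θ₁ θ₂ i j) := by
  have h := ((IsBddProfile.const ((1 : Matrix (Fin 2) (Fin 2) ℂ) i.1 j.1
    * (1 : Matrix (Fin 2) (Fin 2) ℂ) i.2 j.2)).add ((isBddProfile_axis θ₁ θ₂ i.1 j.1).mul
    (isBddProfile_axis θ₂ θ₁ i.2 j.2))).mul (.const 2⁻¹)
  simp only [← div_eq_mul_inv] at h
  exact h

theorem isBddProfile_rotatingBand (σ : ℂ) (θ₁ θ₂ : ℝ) (i j : Coin) :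
    IsBddProfile (rotatingBand σ θ₁ θ₂ i j) :=
  have h₁ := isBddProfile_axis θ₁ θ₂ i.1 j.1
  have h₂ := isBddProfile_axis θ₂ θ₁ i.2 j.2
  (IsBddProfile.const _).mul (((IsBddProfile.const _).add ((IsBddProfile.const _).mul
    (h₁.mul h₂))).add ((IsBddProfile.const _).mul
      ((h₁.mul (.const _)).add ((IsBddProfile.const _).mul h₂))))

theorem stepMatrix_pow_apply {θ₁ θ₂ k : ℝ} (h : Real.sin (omega θ₁ θ₂ k) ≠ 0) (t : ℕ)
    (i j : Coin) :
    (stepMatrix θ₁ θ₂ k ^ t) i j = flatBand θ₁ θ₂ i j k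
      + (Complex.exp ((2 * t : ℝ) * omega θ₁ θ₂ k * Complex.I) * rotatingBand 1 θ₁ θ₂ i j k
        + Complex.exp ((-2 * t : ℝ) * omega θ₁ θ₂ k * Complex.I)
          * rotatingBand (-1) θ₁ θ₂ i j k) := by
  have hp : Complex.exp ((2 * t : ℝ) * omega θ₁ θ₂ k * Complex.I)
      = (((Real.cos (t * omega θ₁ θ₂ k) : ℝ) : ℂ)
        + ((Real.sin (t * omega θ₁ θ₂ k) : ℝ) : ℂ) * Complex.I) ^ 2 := by
    rw [Complex.ofReal_cos, Complex.ofReal_sin, ← Complex.exp_mul_I, ← Complex.exp_nat_mul]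
    push_cast
    ring_nf
  have hm : Complex.exp ((-2 * t : ℝ) * omega θ₁ θ₂ k * Complex.I)
      = (((Real.cos (t * omega θ₁ θ₂ k) : ℝ) : ℂ)
        - ((Real.sin (t * omega θ₁ θ₂ k) : ℝ) : ℂ) * Complex.I) ^ 2 := by
    rw [sub_eq_add_neg, ← neg_mul, ← Complex.ofReal_neg, ← Real.sin_neg, ← Real.cos_neg,
      Complex.ofReal_cos, Complex.ofReal_sin, ← Complex.exp_mul_I, ← Complex.exp_nat_mul]
    push_cast
    ring_nf
  have hcs : ((Real.cos (t * omega θ₁ θ₂ k) : ℝ) : ℂ) ^ 2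
      + ((Real.sin (t * omega θ₁ θ₂ k) : ℝ) : ℂ) ^ 2 = 1 := by
    exact_mod_cast Real.cos_sq_add_sin_sq _
  have h' : Real.sin (omega θ₂ θ₁ k) ≠ 0 := by rwa [omega_comm]
  rw [hp, hm, stepMatrix_pow, Matrix.kroneckerMap_apply, factor_pow h, factor_pow h',
    omega_comm θ₁ θ₂]
  simp only [Matrix.add_apply, Matrix.smul_apply, smul_eq_mul, flatBand, rotatingBand]
  generalize ((Real.cos (t * omega θ₁ θ₂ k) : ℝ) : ℂ) = C,
    ((Real.sin (t * omega θ₁ θ₂ k) : ℝ) : ℂ) = S at *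
  generalize (1 : Matrix (Fin 2) (Fin 2) ℂ) i.1 j.1 = d₁,
    (1 : Matrix (Fin 2) (Fin 2) ℂ) i.2 j.2 = d₂, axis θ₁ θ₂ k i.1 j.1 = a₁,
    axis θ₂ θ₁ k i.2 j.2 = a₂
  have hI := Complex.I_sq
  linear_combination ((d₁ * d₂ + a₁ * a₂) / 2) * hcs
    + (C * S * (a₁ * d₂ + d₁ * a₂) - S ^ 2 * (d₁ * d₂ - a₁ * a₂) / 2) * hI

theorem tendsto_amplitude_stepMatrix_pow {θ₁ θ₂ : ℝ} (n₁ : Real.cos θ₁ ≠ 0)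
    (n₂ : Real.cos θ₂ ≠ 0) (i j : Coin) (x : ℤ) :
    Tendsto (fun t : ℕ => amplitude (fun k => (stepMatrix θ₁ θ₂ k ^ t) i j) x) atTop
      (𝓝 (amplitude (flatBand θ₁ θ₂ i j) x)) := by
  have hcast : Tendsto (fun t : ℕ => (t : ℝ)) atTop atTop := tendsto_natCast_atTop_atTop
  have hb := fun σ => (isBddProfile_rotatingBand σ θ₁ θ₂ i j).periodIntegrable
  have hp := (tendsto_amplitude_exp n₁ n₂ (hb 1) x).comp
    ((hcast.const_mul_atTop (by norm_num : (0 : ℝ) < 2)).mono_right atTop_le_cocompact)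
  have hm := (tendsto_amplitude_exp n₁ n₂ (hb (-1)) x).comp
    ((hcast.const_mul_atTop_of_neg (by norm_num : (-2 : ℝ) < 0)).mono_right atBot_le_cocompact)
  have key := (hp.add hm).const_add (amplitude (flatBand θ₁ θ₂ i j) x)
  rw [add_zero, add_zero] at key
  refine key.congr fun t => ?_
  have hexp : ∀ (τ : ℝ) (σ : ℂ), PeriodIntegrable fun k =>
      Complex.exp (τ * omega θ₁ θ₂ k * Complex.I) * rotatingBand σ θ₁ θ₂ i j k := fun τ σ => by
    have := continuous_omega θ₁ θ₂
    exact (hb σ).continuousOn_mul (by fun_prop)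
  rw [amplitude_congr (fun k hk h0 => stepMatrix_pow_apply
    (sin_omega_pos n₁ n₂ (sin_ne_zero_of_mem hk h0)).ne' t i j),
    amplitude_add (isBddProfile_flatBand θ₁ θ₂ i j).periodIntegrable
      ((hexp _ _).add (hexp _ _)), amplitude_add (hexp _ _) (hexp _ _)]
  rfl

/-! ### Fourier coefficients of the flat-band projection -/

theorem periodIntegrable_polePart {c₁ s₁ c₂ s₂ : ℝ} (h₁ : c₁ ^ 2 + s₁ ^ 2 = 1)
    (h₂ : c₂ ^ 2 + s₂ ^ 2 = 1) : PeriodIntegrable (polePart c₁ s₁ c₂ s₂) := by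
  by_cases hs : s₁ = s₂
  · have : polePart c₁ s₁ c₂ s₂ = fun _ => 0 := by
      funext k
      simp [polePart, hs]
    rw [this]
    exact intervalIntegrable_const
  · refine Continuous.intervalIntegrable ?_ _ _
    have hz := continuous_zeta
    have hw := continuous_zeta_inv
    refine continuous_const.div (by fun_prop) fun k h => hs ?_
    have hr : 1 - s₁ * s₂ - c₁ * c₂ * Real.cos k = 0 := by
      have : ((1 - s₁ * s₂ - c₁ * c₂ * Real.cos k : ℝ) : ℂ) = 0 := by
        rw [← h, zeta_inv_eq, zeta_eq]
        push_cast
        ring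
      exact_mod_cast this
    have h3 := Real.cos_sq_add_sin_sq k
    have h4 : (s₁ - s₂) ^ 2 + (c₁ * c₂ * Real.sin k) ^ 2 = 0 := by
      grind
    have h5 : (s₁ - s₂) ^ 2 = 0 := by
      nlinarith [sq_nonneg (s₁ - s₂), sq_nonneg (c₁ * c₂ * Real.sin k)]
    exact sub_eq_zero.1 (pow_eq_zero_iff two_ne_zero |>.1 h5)

theorem amplitude_linear_mul {f : ℝ → ℂ} (hf : PeriodIntegrable f) (a b c : ℂ) (x : ℤ) :
    PeriodIntegrable (fun k => (a + b * zeta k + c * (zeta k)⁻¹) * f k) ∧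
    amplitude (fun k => (a + b * zeta k + c * (zeta k)⁻¹) * f k) x
      = a * amplitude f x + b * amplitude f (x + 1) + c * amplitude f (x - 1) := by
  have h1 := hf.zeta_mul 1
  have h2 := hf.zeta_mul (-1)
  have e : (fun k => (a + b * zeta k + c * (zeta k)⁻¹) * f k)
      = fun k => (a * f k + b * (zeta k ^ (1 : ℤ) * f k)) + c * (zeta k ^ (-1 : ℤ) * f k) := by
    funext k
    rw [zpow_one, zpow_neg_one]
    ring
  have i0 := hf.const_mul a
  have i1 := h1.const_mul b
  have i2 := h2.const_mul c
  rw [e]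
  refine ⟨(i0.add i1).add i2, ?_⟩
  rw [amplitude_add (i0.add i1) i2, amplitude_add i0 i1, amplitude_const_mul, amplitude_const_mul,
    amplitude_const_mul, amplitude_zeta_mul, amplitude_zeta_mul, ← sub_eq_add_neg]

/-- `tracefree` as a function of `z = e^{ik}` and `w = e^{-ik}`. -/
def tracefreeAt (c₁ s₁ c₂ s₂ z w : ℂ) : Matrix (Fin 2) (Fin 2) ℂ :=
  !![c₁ * c₂ * (z - w) / 2, z * c₁ * s₂ - s₁ * c₂;
    s₁ * c₂ - w * c₁ * s₂, -(c₁ * c₂ * (z - w) / 2)]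

/-- A partial fraction expansion of an entry of the flat-band projection with numerators in the span
of `1`, `e^{ik}` and `e^{-ik}` determines its Fourier coefficients. -/
theorem amplitude_flatBand {θ₁ θ₂ : ℝ} (n₁ : Real.cos θ₁ ≠ 0) (n₂ : Real.cos θ₂ ≠ 0)
    {c₁ s₁ c₂ s₂ : ℂ} (hc₁ : c₁ = (Real.cos θ₁ : ℝ)) (hs₁ : s₁ = (Real.sin θ₁ : ℝ))
    (hc₂ : c₂ = (Real.cos θ₂ : ℝ)) (hs₂ : s₂ = (Real.sin θ₂ : ℝ))
    (i j : Coin) (a b c a' b' c' d : ℂ)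
    (h : ∀ z w u : ℂ, z * w = 1 → u = c₁ * c₂ * (z + w) / 2 + s₁ * s₂ →
      (1 : Matrix (Fin 2) (Fin 2) ℂ) i.1 j.1 * (1 : Matrix (Fin 2) (Fin 2) ℂ) i.2 j.2 * (1 - u ^ 2)
        + tracefreeAt c₁ s₁ c₂ s₂ z w i.1 j.1 * tracefreeAt c₂ s₂ c₁ s₁ z w i.2 j.2
      = 2 * ((a + b * z + c * w) * (s₁ - s₂) * (1 + u) + (a' + b' * z + c' * w) * (s₁ + s₂) * (1 - u)
        + d * (1 - u ^ 2))) (x : ℤ) :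
    amplitude (flatBand θ₁ θ₂ i j) x
      = a * mode₁ θ₁ θ₂ x + b * mode₁ θ₁ θ₂ (x + 1) + c * mode₁ θ₁ θ₂ (x - 1)
        + (a' * mode₂ θ₁ θ₂ x + b' * mode₂ θ₁ θ₂ (x + 1) + c' * mode₂ θ₁ θ₂ (x - 1))
        + d * (ind (x = 0) : ℝ) := by
  have e₁ := Real.cos_sq_add_sin_sq θ₁
  have e₂ := Real.cos_sq_add_sin_sq θ₂
  have e₂' : (-Real.cos θ₂) ^ 2 + (-Real.sin θ₂) ^ 2 = 1 := by rw [neg_sq, neg_sq, e₂]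
  have n₂' : -Real.cos θ₂ ≠ 0 := neg_ne_zero.2 n₂
  have m₁ : ∀ y, amplitude (polePart (Real.cos θ₁) (Real.sin θ₁) (Real.cos θ₂) (Real.sin θ₂)) y
      = mode₁ θ₁ θ₂ y := amplitude_polePart e₁ e₂ n₁ n₂
  have m₂ : ∀ y, amplitude (polePart (Real.cos θ₁) (Real.sin θ₁) (-Real.cos θ₂) (-Real.sin θ₂)) y
      = mode₂ θ₁ θ₂ y := fun y => by
    rw [amplitude_polePart e₁ e₂' n₁ n₂', mode₂, ν₂_eq, sub_neg_eq_add]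
  obtain ⟨i₁, a₁⟩ := amplitude_linear_mul (periodIntegrable_polePart e₁ e₂) a b c x
  obtain ⟨i₂, a₂⟩ := amplitude_linear_mul (periodIntegrable_polePart e₁ e₂') a' b' c' x
  have i₃ : PeriodIntegrable fun _ => d * 1 := intervalIntegrable_const
  simp only [m₁] at a₁
  simp only [m₂] at a₂
  have hind : ((ind (x = 0) : ℝ) : ℂ) = if x = 0 then 1 else 0 := by
    unfold ind
    split_ifs <;> simp
  rw [hind, ← a₁, ← a₂, ← amplitude_one, ← amplitude_const_mul, ← amplitude_add i₁ i₂,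
    ← amplitude_add (i₁.add i₂) i₃]
  refine amplitude_congr (fun k hk h0 => ?_) x
  have hsin := sin_omega_pos n₁ n₂ (sin_ne_zero_of_mem hk h0)
  have hsq := sin_omega_sq θ₁ θ₂ k
  have hu := cosOmega_eq θ₁ θ₂ k
  have hS : ((Real.sin (omega θ₁ θ₂ k) : ℝ) : ℂ) ≠ 0 := by exact_mod_cast hsin.ne'
  have hsqC : ((Real.sin (omega θ₁ θ₂ k) : ℝ) : ℂ) ^ 2
      = (1 - cosOmega θ₁ θ₂ k) * (1 + cosOmega θ₁ θ₂ k) := by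
    rw [← Complex.ofReal_pow, hsq]
    push_cast
    ring
  have hne := hsqC ▸ pow_ne_zero 2 hS
  have hD₁ := left_ne_zero_of_mul hne
  have hD₂ := right_ne_zero_of_mul hne
  have p₁ : polePart (Real.cos θ₁) (Real.sin θ₁) (Real.cos θ₂) (Real.sin θ₂) k
      = (s₁ - s₂) / (1 - cosOmega θ₁ θ₂ k) := by
    rw [polePart, hs₁, hs₂, hu]
    congr 1
    · push_cast
      ring
    · push_cast
      ring
  have p₂ : polePart (Real.cos θ₁) (Real.sin θ₁) (-Real.cos θ₂) (-Real.sin θ₂) k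
      = (s₁ + s₂) / (1 + cosOmega θ₁ θ₂ k) := by
    rw [polePart, hs₁, hs₂, hu]
    congr 1
    · push_cast
      ring
    · push_cast
      ring
  have key := h (zeta k) (zeta k)⁻¹ (cosOmega θ₁ θ₂ k) (mul_inv_cancel₀ (zeta_ne_zero k))
    (by rw [hu, hc₁, hc₂, hs₁, hs₂])
  have t₁ : axis θ₁ θ₂ k i.1 j.1 = ((Real.sin (omega θ₁ θ₂ k) : ℝ) : ℂ)⁻¹
      * tracefreeAt c₁ s₁ c₂ s₂ (zeta k) (zeta k)⁻¹ i.1 j.1 := by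
    rw [hc₁, hc₂, hs₁, hs₂]
    rfl
  have t₂ : axis θ₂ θ₁ k i.2 j.2 = ((Real.sin (omega θ₁ θ₂ k) : ℝ) : ℂ)⁻¹
      * tracefreeAt c₂ s₂ c₁ s₁ (zeta k) (zeta k)⁻¹ i.2 j.2 := by
    rw [hc₁, hc₂, hs₁, hs₂, ← omega_comm]
    rfl
  rw [flatBand, p₁, p₂, t₁, t₂]
  generalize tracefreeAt c₁ s₁ c₂ s₂ (zeta k) (zeta k)⁻¹ i.1 j.1 = T₁,
    tracefreeAt c₂ s₂ c₁ s₁ (zeta k) (zeta k)⁻¹ i.2 j.2 = T₂ at *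
  have hT : ((Real.sin (omega θ₁ θ₂ k) : ℝ) : ℂ)⁻¹ * T₁ *
      (((Real.sin (omega θ₁ θ₂ k) : ℝ) : ℂ)⁻¹ * T₂)
      = T₁ * T₂ / ((1 - cosOmega θ₁ θ₂ k) * (1 + cosOmega θ₁ θ₂ k)) := by
    rw [← hsqC]
    field_simp
  rw [hT]
  field_simp
  linear_combination key

section
variable {θ₁ θ₂ : ℝ}

theorem η₁_neg_add_one (x : ℤ) : η₁ θ₁ θ₂ (-x + 1) = η₁ θ₁ θ₂ (x - 1) := by
  rw [η₁_eq, η₁_eq, ← mode₁_neg, ← mode₂_neg, neg_add, neg_neg, ← sub_eq_add_neg]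

theorem η₁_neg (x : ℤ) : η₁ θ₁ θ₂ (-x) = η₁ θ₁ θ₂ x := by
  rw [η₁_eq, η₁_eq, mode₁_neg, mode₂_neg]

variable (n₁ : Real.cos θ₁ ≠ 0) (n₂ : Real.cos θ₂ ≠ 0)

include n₁ n₂ in
theorem η₃_neg (x : ℤ) :
    η₃ θ₁ θ₂ (-x) = (Real.cos θ₁ * (mode₁ θ₁ θ₂ x + mode₂ θ₁ θ₂ x)
      - Real.cos θ₂ * (mode₁ θ₁ θ₂ (x - 1) - mode₂ θ₁ θ₂ (x - 1))) / 4 := by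
  rw [η₃_eq n₁ n₂, mode₁_neg, mode₂_neg, ← mode₁_neg _ _ (-x + 1), ← mode₂_neg _ _ (-x + 1),
    neg_add, neg_neg, ← sub_eq_add_neg]

include n₁ n₂ in
theorem η₃_neg_sub_one (x : ℤ) :
    η₃ θ₁ θ₂ (-x - 1) = (Real.cos θ₁ * (mode₁ θ₁ θ₂ (x + 1) + mode₂ θ₁ θ₂ (x + 1))
      - Real.cos θ₂ * (mode₁ θ₁ θ₂ x - mode₂ θ₁ θ₂ x)) / 4 := by
  have := η₃_neg n₁ n₂ (x + 1)
  rwa [add_sub_cancel_right, neg_add, ← sub_eq_add_neg] at this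

include n₁ n₂ in
theorem η₂_neg (x : ℤ) :
    η₂ θ₁ θ₂ (-x) = (-(2 * Real.sin θ₂ * Real.cos θ₁ / Real.cos θ₂)
        * (mode₁ θ₁ θ₂ x + mode₂ θ₁ θ₂ x)
      + (Real.sin θ₁ + Real.sin θ₂) * mode₁ θ₁ θ₂ (x - 1)
      + (Real.sin θ₁ - Real.sin θ₂) * mode₂ θ₁ θ₂ (x - 1)) / 4 := by
  rw [η₂_eq n₁ n₂, mode₁_neg, mode₂_neg, ← mode₁_neg _ _ (-x + 1), ← mode₂_neg _ _ (-x + 1),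
    neg_add, neg_neg, ← sub_eq_add_neg]

end

/-- Complex names for `cos θ` and `sin θ`, opaque to `simp`, for the polynomial identities below. -/
theorem exists_complex_cos_sin {θ : ℝ} (n : Real.cos θ ≠ 0) :
    ∃ c s : ℂ, c = (Real.cos θ : ℝ) ∧ s = (Real.sin θ : ℝ) ∧ c ^ 2 + s ^ 2 = 1 ∧ c ≠ 0 :=
  ⟨_, _, rfl, rfl, by exact_mod_cast Real.cos_sq_add_sin_sq θ, by exact_mod_cast n⟩

section
variable {θ₁ θ₂ : ℝ} (n₁ : Real.cos θ₁ ≠ 0) (n₂ : Real.cos θ₂ ≠ 0)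

include n₁ n₂ in
/-- The row of the coin state `00` in the Fourier coefficients of the flat-band projection: the
coefficients of `ξ₁ x`. The three lemmas after it treat the other rows, `ξ₂` and the two reflected
forms. In each entry the explicit arguments are the numerators of its partial fractions, read off
from the expression of `η₁`, `η₂`, `η₃` through `mode₁`, `mode₂`. -/
theorem amplitude_flatBand_00 (x : ℤ) :
    amplitude (flatBand θ₁ θ₂ (0, 0) (0, 0)) x = (η₁ θ₁ θ₂ x : ℂ) ∧
    amplitude (flatBand θ₁ θ₂ (0, 0) (0, 1)) x = -(η₃ θ₁ θ₂ x : ℂ) ∧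
    amplitude (flatBand θ₁ θ₂ (0, 0) (1, 0)) x = -(η₃ θ₁ θ₂ (-x - 1) : ℂ) ∧
    amplitude (flatBand θ₁ θ₂ (0, 0) (1, 1)) x = -(η₁ θ₁ θ₂ (x + 1) : ℂ) := by
  obtain ⟨c₁, s₁, hc₁, hs₁, e₁, -⟩ := exists_complex_cos_sin n₁
  obtain ⟨c₂, s₂, hc₂, hs₂, e₂, hc0⟩ := exists_complex_cos_sin n₂
  have key := fun i j a b c a' b' c' d h =>
    amplitude_flatBand n₁ n₂ hc₁ hs₁ hc₂ hs₂ i j a b c a' b' c' d h x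
  refine ⟨?_, ?_, ?_, ?_⟩
  · rw [key (0, 0) (0, 0)
      ((s₁ - s₂) / 4) 0 0 ((s₁ + s₂) / 4) 0 0 0
      fun z w u hzw hu => ?_, η₁_eq]
    · push_cast [hc₁, hs₁, hc₂, hs₂]
      ring
    · simp [tracefreeAt]
      grind
  · rw [key (0, 0) (0, 1)
      (-(c₁ / 4)) (c₂ / 4) 0 (-(c₁ / 4)) (-(c₂ / 4)) 0 0
      fun z w u hzw hu => ?_, η₃_eq n₁ n₂]
    · push_cast [hc₁, hs₁, hc₂, hs₂]
      ring
    · simp [tracefreeAt]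
      grind
  · rw [key (0, 0) (1, 0)
      (c₂ / 4) (-(c₁ / 4)) 0 (-(c₂ / 4)) (-(c₁ / 4)) 0 0
      fun z w u hzw hu => ?_, η₃_neg_sub_one n₁ n₂]
    · push_cast [hc₁, hs₁, hc₂, hs₂]
      ring
    · simp [tracefreeAt]
      grind
  · rw [key (0, 0) (1, 1)
      0 (-((s₁ - s₂) / 4)) 0 0 (-((s₁ + s₂) / 4)) 0 0
      fun z w u hzw hu => ?_, η₁_eq]
    · push_cast [hc₁, hs₁, hc₂, hs₂]
      ring
    · simp [tracefreeAt]
      grind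

include n₁ n₂ in
theorem amplitude_flatBand_01 (x : ℤ) :
    amplitude (flatBand θ₁ θ₂ (0, 1) (0, 0)) x = -(η₃ θ₁ θ₂ (-x) : ℂ) ∧
    amplitude (flatBand θ₁ θ₂ (0, 1) (0, 1)) x = ((ind (x = 0) - η₁ θ₁ θ₂ x : ℝ) : ℂ) ∧
    amplitude (flatBand θ₁ θ₂ (0, 1) (1, 0)) x = (η₂ θ₁ θ₂ (-x) : ℂ) ∧
    amplitude (flatBand θ₁ θ₂ (0, 1) (1, 1)) x = (η₃ θ₁ θ₂ (-x - 1) : ℂ) := by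
  obtain ⟨c₁, s₁, hc₁, hs₁, e₁, -⟩ := exists_complex_cos_sin n₁
  obtain ⟨c₂, s₂, hc₂, hs₂, e₂, hc0⟩ := exists_complex_cos_sin n₂
  have key := fun i j a b c a' b' c' d h =>
    amplitude_flatBand n₁ n₂ hc₁ hs₁ hc₂ hs₂ i j a b c a' b' c' d h x
  refine ⟨?_, ?_, ?_, ?_⟩
  · rw [key (0, 1) (0, 0)
      (-(c₁ / 4)) 0 (c₂ / 4) (-(c₁ / 4)) 0 (-(c₂ / 4)) 0
      fun z w u hzw hu => ?_, η₃_neg n₁ n₂]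
    · push_cast [hc₁, hs₁, hc₂, hs₂]
      ring
    · simp [tracefreeAt]
      grind
  · rw [key (0, 1) (0, 1)
      (-((s₁ - s₂) / 4)) 0 0 (-((s₁ + s₂) / 4)) 0 0 1
      fun z w u hzw hu => ?_, η₁_eq]
    · push_cast [hc₁, hs₁, hc₂, hs₂]
      ring
    · simp [tracefreeAt]
      grind
  · rw [key (0, 1) (1, 0)
      (-(s₂ * (c₁ / c₂)) / 2) 0 ((s₁ + s₂) / 4) (-(s₂ * (c₁ / c₂)) / 2) 0 ((s₁ - s₂) / 4) 0
      fun z w u hzw hu => ?_, η₂_neg n₁ n₂]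
    · push_cast [hc₁, hs₁, hc₂, hs₂]
      ring
    · simp [tracefreeAt]
      -- `s₁ - s₂ u` is divisible by `c₂`, which clears the only denominator
      have e : s₂ * (c₁ / c₂) * (s₁ - s₂ * u)
          = s₂ * c₁ * (s₁ * c₂ - s₂ * c₁ * (z + w) / 2) := by
        rw [← mul_div_assoc, div_mul_eq_mul_div, div_eq_iff hc0]
        grind
      grind
  · rw [key (0, 1) (1, 1)
      (-c₂ / 4) (c₁ / 4) 0 (c₂ / 4) (c₁ / 4) 0 0
      fun z w u hzw hu => ?_, η₃_neg_sub_one n₁ n₂]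
    · push_cast [hc₁, hs₁, hc₂, hs₂]
      ring
    · simp [tracefreeAt]
      grind

include n₁ n₂ in
theorem amplitude_flatBand_10 (x : ℤ) :
    amplitude (flatBand θ₁ θ₂ (1, 0) (0, 0)) x = -(η₃ θ₁ θ₂ (x - 1) : ℂ) ∧
    amplitude (flatBand θ₁ θ₂ (1, 0) (0, 1)) x = (η₂ θ₁ θ₂ x : ℂ) ∧
    amplitude (flatBand θ₁ θ₂ (1, 0) (1, 0)) x = ((ind (x = 0) - η₁ θ₁ θ₂ x : ℝ) : ℂ) ∧
    amplitude (flatBand θ₁ θ₂ (1, 0) (1, 1)) x = (η₃ θ₁ θ₂ x : ℂ) := by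
  obtain ⟨c₁, s₁, hc₁, hs₁, e₁, -⟩ := exists_complex_cos_sin n₁
  obtain ⟨c₂, s₂, hc₂, hs₂, e₂, hc0⟩ := exists_complex_cos_sin n₂
  have key := fun i j a b c a' b' c' d h =>
    amplitude_flatBand n₁ n₂ hc₁ hs₁ hc₂ hs₂ i j a b c a' b' c' d h x
  refine ⟨?_, ?_, ?_, ?_⟩
  · rw [key (1, 0) (0, 0)
      (c₂ / 4) 0 (-(c₁ / 4)) (-(c₂ / 4)) 0 (-(c₁ / 4)) 0
      fun z w u hzw hu => ?_, η₃_eq n₁ n₂, sub_add_cancel]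
    · push_cast [hc₁, hs₁, hc₂, hs₂]
      ring
    · simp [tracefreeAt]
      grind
  · rw [key (1, 0) (0, 1)
      (-(s₂ * (c₁ / c₂)) / 2) ((s₁ + s₂) / 4) 0 (-(s₂ * (c₁ / c₂)) / 2) ((s₁ - s₂) / 4) 0 0
      fun z w u hzw hu => ?_, η₂_eq n₁ n₂]
    · push_cast [hc₁, hs₁, hc₂, hs₂]
      ring
    · simp [tracefreeAt]
      -- `s₁ - s₂ u` is divisible by `c₂`, which clears the only denominator
      have e : s₂ * (c₁ / c₂) * (s₁ - s₂ * u)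
          = s₂ * c₁ * (s₁ * c₂ - s₂ * c₁ * (z + w) / 2) := by
        rw [← mul_div_assoc, div_mul_eq_mul_div, div_eq_iff hc0]
        grind
      grind
  · rw [key (1, 0) (1, 0)
      (-((s₁ - s₂) / 4)) 0 0 (-((s₁ + s₂) / 4)) 0 0 1
      fun z w u hzw hu => ?_, η₁_eq]
    · push_cast [hc₁, hs₁, hc₂, hs₂]
      ring
    · simp [tracefreeAt]
      grind
  · rw [key (1, 0) (1, 1)
      (c₁ / 4) (-c₂ / 4) 0 (c₁ / 4) (c₂ / 4) 0 0
      fun z w u hzw hu => ?_, η₃_eq n₁ n₂]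
    · push_cast [hc₁, hs₁, hc₂, hs₂]
      ring
    · simp [tracefreeAt]
      grind

include n₁ n₂ in
theorem amplitude_flatBand_11 (x : ℤ) :
    amplitude (flatBand θ₁ θ₂ (1, 1) (0, 0)) x = -(η₁ θ₁ θ₂ (x - 1) : ℂ) ∧
    amplitude (flatBand θ₁ θ₂ (1, 1) (0, 1)) x = (η₃ θ₁ θ₂ (x - 1) : ℂ) ∧
    amplitude (flatBand θ₁ θ₂ (1, 1) (1, 0)) x = (η₃ θ₁ θ₂ (-x) : ℂ) ∧
    amplitude (flatBand θ₁ θ₂ (1, 1) (1, 1)) x = (η₁ θ₁ θ₂ x : ℂ) := by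
  obtain ⟨c₁, s₁, hc₁, hs₁, e₁, -⟩ := exists_complex_cos_sin n₁
  obtain ⟨c₂, s₂, hc₂, hs₂, e₂, hc0⟩ := exists_complex_cos_sin n₂
  have key := fun i j a b c a' b' c' d h =>
    amplitude_flatBand n₁ n₂ hc₁ hs₁ hc₂ hs₂ i j a b c a' b' c' d h x
  refine ⟨?_, ?_, ?_, ?_⟩
  · rw [key (1, 1) (0, 0)
      0 0 (-((s₁ - s₂) / 4)) 0 0 (-((s₁ + s₂) / 4)) 0
      fun z w u hzw hu => ?_, η₁_eq]
    · push_cast [hc₁, hs₁, hc₂, hs₂]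
      ring
    · simp [tracefreeAt]
      grind
  · rw [key (1, 1) (0, 1)
      (-c₂ / 4) 0 (c₁ / 4) (c₂ / 4) 0 (c₁ / 4) 0
      fun z w u hzw hu => ?_, η₃_eq n₁ n₂, sub_add_cancel]
    · push_cast [hc₁, hs₁, hc₂, hs₂]
      ring
    · simp [tracefreeAt]
      grind
  · rw [key (1, 1) (1, 0)
      (c₁ / 4) 0 (-c₂ / 4) (c₁ / 4) 0 (c₂ / 4) 0
      fun z w u hzw hu => ?_, η₃_neg n₁ n₂]
    · push_cast [hc₁, hs₁, hc₂, hs₂]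
      ring
    · simp [tracefreeAt]
      grind
  · rw [key (1, 1) (1, 1)
      ((s₁ - s₂) / 4) 0 0 ((s₁ + s₂) / 4) 0 0 0
      fun z w u hzw hu => ?_, η₁_eq]
    · push_cast [hc₁, hs₁, hc₂, hs₂]
      ring
    · simp [tracefreeAt]
      grind

end

end

end FourStateWalk

/-! ### The limit distribution -/

theorem FourStateWalk.cos_ne_zero_of_ne_mul {θ : ℝ} (h : ∀ n : ℤ, θ ≠ n * (Real.pi / 2)) :
    Real.cos θ ≠ 0 := by
  rw [Ne, Real.cos_eq_zero_iff]
  rintro ⟨k, hk⟩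
  refine h (2 * k + 1) ?_
  rw [hk]
  push_cast
  ring

open FourStateWalk in
theorem theorem1 (θ₁ θ₂ : ℝ)
    (hθ₁ : ∀ n : ℤ, θ₁ ≠ n * (Real.pi / 2)) (hθ₂ : ∀ n : ℤ, θ₂ ≠ n * (Real.pi / 2))
    (q₀ q₁ q₂ q₃ : ℂ) (hq : ‖q₀‖ ^ 2 + ‖q₁‖ ^ 2 + ‖q₂‖ ^ 2 + ‖q₃‖ ^ 2 = 1) (x : ℤ) :
    Tendsto (fun t : ℕ => FourStateWalk.prob θ₁ θ₂ q₀ q₁ q₂ q₃ t x) atTop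
      (𝓝 (‖FourStateWalk.ξ₁ θ₁ θ₂ x q₀ q₁ q₂ q₃‖ ^ 2
        + ‖FourStateWalk.ξ₁ θ₁ θ₂ (-x) q₃ (-q₂) (-q₁) q₀‖ ^ 2
        + ‖FourStateWalk.ξ₂ θ₁ θ₂ x q₀ q₁ q₂ q₃‖ ^ 2
        + ‖FourStateWalk.ξ₂ θ₁ θ₂ (-x) (-q₃) q₂ q₁ (-q₀)‖ ^ 2)) := by
  have n₁ := cos_ne_zero_of_ne_mul hθ₁
  have n₂ := cos_ne_zero_of_ne_mul hθ₂
  have hlim : ∀ j : Coin, Tendsto (fun t : ℕ => state θ₁ θ₂ q₀ q₁ q₂ q₃ t x j) atTop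
      (𝓝 (∑ i : Coin, amplitude (flatBand θ₁ θ₂ j i) x * !![q₀, q₁; q₂, q₃] i.1 i.2)) := by
    intro j
    simp only [state_eq_amplitude]
    exact tendsto_finsetSum _ fun i _ =>
      (tendsto_amplitude_stepMatrix_pow n₁ n₂ j i x).mul_const _
  have hprob := tendsto_finsetSum Finset.univ fun j (_ : j ∈ Finset.univ) => (hlim j).norm.pow 2
  refine (hprob.congr fun t => rfl).trans_eq (congrArg 𝓝 ?_)
  obtain ⟨a₁, a₂, a₃, a₄⟩ := amplitude_flatBand_00 n₁ n₂ x
  obtain ⟨b₁, b₂, b₃, b₄⟩ := amplitude_flatBand_01 n₁ n₂ x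
  obtain ⟨c₁, c₂, c₃, c₄⟩ := amplitude_flatBand_10 n₁ n₂ x
  obtain ⟨d₁, d₂, d₃, d₄⟩ := amplitude_flatBand_11 n₁ n₂ x
  have hind : ind (-x = 0) = ind (x = 0) := by simp only [ind, neg_eq_zero]
  simp only [Fintype.sum_prod_type, Fin.sum_univ_two, a₁, a₂, a₃, a₄, b₁, b₂, b₃, b₄, c₁, c₂, c₃, c₄,
    d₁, d₂, d₃, d₄, ξ₁, ξ₂, hind, η₁_neg, η₁_neg_add_one, neg_neg, Matrix.of_apply,
    Matrix.cons_val', Matrix.cons_val_zero, Matrix.cons_val_one, Matrix.cons_val_fin_one]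
  ring_nf
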